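/- Let $d\ge 0$ and $\alpha\ge 1$ be integers, $\gamma,\eta>0$, and let $U\in C^{\alpha}(\mathbb R^d,\mathbb R)$. Let $P_{\alpha-1}(x)=\sum_{j=0}^{\alpha-1}\frac1{j!}D^j(\nabla U)(0)[x,\dots,x]$ be the Taylor polynomial of degree $\alpha-1$ of $\nabla U$ at the origin. Let $B$ be a standard $d$-dimensional Brownian motion and $x^{(0)}$ a random vector in $\mathbb R^{4d}$ independent of $B$. Vectors of $\mathbb R^{4d}$ are written $x=(\theta,v_1,v_2,v_3)$ with blocks in $\mathbb R^d$. *The scheme.* Given $x^{(k)}=(\theta^{(k)},v_1^{(k)},v_2^{(k)},v_3^{(k)})$, let $\hat x,\tilde x,\bar x$ be the continuous processes on $[k\eta,(k+1)\eta]$ that start at $x^{(k)}$ at time $k\eta$ and satisfy there - $\hat v_1=v_1^{(k)}$, $\ d\hat\theta=\hat v_1dt$, $\ d\hat v_2=(-\gamma\hat v_1+\gamma v_3^{(k)})dt$, $\ d\hat v_3=(-\gamma\hat v_2-\gamma\hat v_3)dt+\sqrt{2\gamma}\,dB_t$; - $d\tilde\theta=\tilde v_1dt$, $\ d\tilde v_1=(-P_{\alpha-1}(\hat\theta)+\gamma\hat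 v_2)dt$, $\ d\tilde v_2=(-\gamma\tilde v_1+\gamma\hat v_3)dt$, $\ d\tilde v_3=(-\gamma\tilde v_2-\gamma\tilde v_3)dt+\sqrt{2\gamma}\,dB_t$; - $d\bar\theta=\bar v_1dt$, $\ d\bar v_1=(-P_{\alpha-1}(\tilde\theta)+\gamma\tilde v_2)dt$, $\ d\bar v_2=(-\gamma\bar v_1+\gamma\tilde v_3)dt$, $\ d\bar v_3=(-\gamma\bar v_2-\gamma\bar v_3)dt+\sqrt{2\gamma}\,dB_t$; all three with the same $B$, and set $x^{(k+1)}=\bar x((k+1)\eta)$. *Claim.* For every $k\ge 0$, the conditional law of $x^{(k+1)}$ given $x^{(k)}$ is, almost surely, the multivariate normal law on $\mathbb R^{4d}$ with mean $\mathbf M(x^{(k)})$ and (positive semidefinite) covariance matrix $\boldsymbol\Sigma=(\sigma_{ij}I_d)_{0\le i,j\le 3}$, where $\mathbf M$ and $\boldsymbol\Sigma$ are as follows. Put $s=\gamma\eta$, $e=e^{-\gamma\eta}$ and, for $x=(\theta,v_1,v_2,v_3)$ and $0\le r\le\eta$, $$\tilde g(r)=P_{\alpha-1}(\theta+rv_1),\qquad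 \bar g(r)=P_{\alpha-1}\Big(\theta+rv_1-\int_0^r\!\!\int_0^{p}\tilde g(q)\,dq\,dp+\tfrac{\gamma r^2}{2}v_2+\tfrac{\gamma^2r^3}{6}(v_3-v_1)\Big).$$ With $u=\eta-r$, $\mathbf M(x)=(m_0,m_1,m_2,m_3)$ is given by $$\begin{aligned} m_0&=-\int_0^\eta u\,\bar g(r)dr+\int_0^\eta\tfrac{\gamma^2u^3}{6}\tilde g(r)dr+\mu_{00}\theta+\mu_{01}v_1+\mu_{02}v_2+\mu_{03}v_3,\\ m_1&=-\int_0^\eta \bar g(r)dr+\int_0^\eta\tfrac{\gamma^2u^2}{2}\tilde g(r)dr+\mu_{10}\theta+\mu_{11}v_1+\mu_{12}v_2+\mu_{13}v_3,\\ m_2&=\int_0^\eta \gamma u\,\bar g(r)dr-\int_0^\eta\Big(\tfrac{(\gamma u)^3}{6}+\tfrac{(\gamma u)^2}{2}-\gamma u+1-e^{-\gamma u}\Big)\tilde g(r)dr+\mu_{20}\theta+\mu_{21}v_1+\mu_{22}v_2+\mu_{23}v_3,\\ m_3&=-\int_0^\eta(\gamma u-1+e^{-\gamma u})\bar g(r)dr+\int_0^\eta\Big(\tfrac{(\gamma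 u)^3}{6}-\gamma u+2-(2+\gamma u)e^{-\gamma u}\Big)\tilde g(r)dr+\mu_{30}\theta+\mu_{31}v_1+\mu_{32}v_2+\mu_{33}v_3, \end{aligned}$$ where $\mu_{00}=1$, $\mu_{10}=\mu_{20}=\mu_{30}=0$ and $$\begin{aligned} \mu_{01}&=\tfrac1\gamma\big(1+\tfrac{s^2}2-\tfrac{s^3}3+\tfrac{s^4}{24}+\tfrac{s^5}{120}-e\big),\quad \mu_{02}=\tfrac1\gamma\big(1-s+s^2-\tfrac{s^3}6-\tfrac{s^4}{24}-e\big),\quad \mu_{03}=\tfrac1\gamma\big(\tfrac{s^3}6-\tfrac{s^4}{24}-\tfrac{s^5}{120}\big),\\ \mu_{11}&=s-s^2+\tfrac{s^3}6+\tfrac{s^4}{24}+e,\quad \mu_{12}=-1+2s-\tfrac{s^2}2-\tfrac{s^3}6+e,\quad \mu_{13}=\tfrac{s^2}2-\tfrac{s^3}6-\tfrac{s^4}{24},\\ \mu_{21}&=3-3s+\tfrac{s^2}2+\tfrac{s^3}3-\tfrac{s^4}{12}-\tfrac{s^5}{120}-(3+s)e,\quad \mu_{22}=3-s-s^2+\tfrac{s^3}3+\tfrac{s^4}{24}-(2+s)e,\\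 \mu_{23}&=s-\tfrac{s^2}2-\tfrac{s^3}6+\tfrac{s^4}{12}+\tfrac{s^5}{120},\\ \mu_{31}&=-4+s+s^2-\tfrac{s^3}2+\tfrac{s^4}{24}+\tfrac{s^5}{120}+(4+3s+\tfrac{s^2}2)e,\\ \mu_{32}&=-1-2s+\tfrac{3s^2}2-\tfrac{s^3}6-\tfrac{s^4}{24}+(1+2s+\tfrac{s^2}2)e,\quad \mu_{33}=-\tfrac{s^2}2+\tfrac{s^3}3-\tfrac{s^4}{24}-\tfrac{s^5}{120}+e, \end{aligned}$$ and $\sigma_{ij}=\sigma_{ji}$ with $$\begin{aligned} \sigma_{00}&=\tfrac1{\gamma^2}\big(-3+2s-2s^2+\tfrac{4s^3}3-\tfrac{s^4}2+\tfrac{s^5}{10}+(4+2s^2)e-e^2\big),\\ \sigma_{01}&=\tfrac1\gamma\big(1-2s+2s^2-s^3+\tfrac{s^4}4+(-2+2s-s^2)e+e^2\big),\\ \sigma_{02}&=\tfrac1\gamma\big(-\tfrac{15}2+4s-2s^2+\tfrac{s^3}3+\tfrac{s^4}4-\tfrac{s^5}{10}+(10+2s+2s^2+s^3)e-(\tfrac52+s)e^2\big),\\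 \sigma_{03}&=\tfrac1\gamma\big(\tfrac{75}4-2s+\tfrac{2s^3}3-\tfrac{s^4}2+\tfrac{s^5}{10}-(22+16s+7s^2+3s^3+\tfrac{s^4}2)e+(\tfrac{13}4+\tfrac{5s}2+\tfrac{s^2}2)e^2\big),\\ \sigma_{11}&=1+2s-2s^2+\tfrac{2s^3}3-4se-e^2,\\ \sigma_{12}&=-\tfrac52-4s+2s^2+\tfrac{s^3}3-\tfrac{s^4}4+(8s+3s^2)e+(\tfrac52+s)e^2,\\ \sigma_{13}&=\tfrac{37}4+2s-s^3+\tfrac{s^4}4-(6+12s+7s^2+s^3)e-(\tfrac{13}4+\tfrac{5s}2+\tfrac{s^2}2)e^2,\\ \sigma_{22}&=\tfrac52+8s-\tfrac{4s^3}3+\tfrac{s^5}{10}+(4-12s-10s^2-2s^3)e-(\tfrac{13}2+5s+s^2)e^2,\\ \sigma_{23}&=-\tfrac{103}8-4s-2s^2+s^3+\tfrac{s^4}4-\tfrac{s^5}{10}+(4+16s+15s^2+5s^3+\tfrac{s^4}2)e+(\tfrac{71}8+\tfrac{39s}4+\tfrac{15s^2}4+\tfrac{s^3}2)e^2,\\ \sigma_{33}&=\tfrac{103}8+2s+2s^2-\tfrac{s^4}2+\tfrac{s^5}{10}-(8s+12s^2+6s^3+s^4)e-(\tfrac{103}8+\tfrac{71s}4+\tfrac{39s^2}4+\tfrac{5s^3}2+\tfrac{s^4}4)e^2.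 \end{aligned}$$ -/

import Mathlib

open MeasureTheory ProbabilityTheory
open scoped NNReal Kronecker

noncomputable section

namespace FourthLMC

/-- Positions and velocities: the Euclidean space `ℝ^d`. -/
abbrev Vec (d : ℕ) : Type := EuclideanSpace ℝ (Fin d)

/-- The phase space `ℝ^{4d}`; the index `(i, j)` is the `j`-th coordinate of the `i`-th block,
where the blocks are `θ, v₁, v₂, v₃` in this order. -/
abbrev Phase (d : ℕ) : Type := EuclideanSpace ℝ (Fin 4 × Fin d)

/-- The `i`-th block of a phase space vector. -/
def block {d : ℕ} (i : Fin 4) (x : Phase d) : Vec d :=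
  WithLp.toLp 2 fun j => x (i, j)

/-- The phase space vector with given blocks. -/
def assemble {d : ℕ} (y : Fin 4 → Vec d) : Phase d :=
  WithLp.toLp 2 fun p => y p.1 p.2

/-- A `d`-dimensional standard Brownian motion: the coordinates are independent real
Brownian motions. -/
structure IsBrownianMotion {Ω : Type*} [MeasurableSpace Ω] {d : ℕ}
    (B : ℝ≥0 → Ω → Vec d) (P : Measure Ω) : Prop where
  measurable : ∀ t, Measurable (B t)
  coord : ∀ j, IsBrownianReal (fun t ω => B t ω j) P
  indep : iIndepFun (fun (j : Fin d) (ω : Ω) (t : ℝ≥0) => B t ω j) P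

/-- The Taylor polynomial of degree `α - 1` of the gradient field `∇U`, centred at the origin. -/
def gradTaylor {d : ℕ} (U : Vec d → ℝ) (α : ℕ) (x : Vec d) : Vec d :=
  ∑ j ∈ Finset.range α,
    ((j.factorial : ℝ)⁻¹) • iteratedFDeriv ℝ j (gradient U) 0 (fun _ => x)

/-- `X` is, on `[a, b]`, the first stage path started at `x` and driven by the path `w`:
`v₁` is frozen at its initial value and
`dθ = v₁ dt`, `dv₂ = (-γ v₁ + γ v₃(a)) dt`, `dv₃ = (-γ v₂ - γ v₃) dt + √(2γ) dw`.
The noise is additive, so the equations are imposed in integrated form along the path. -/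
structure SolvesFirstStage {d : ℕ} (γ a b : ℝ) (w : ℝ → Vec d) (x : Phase d)
    (X : ℝ → Phase d) : Prop where
  continuousOn : ContinuousOn X (Set.Icc a b)
  theta : ∀ t ∈ Set.Icc a b,
    block 0 (X t) = block 0 x + ∫ s in a..t, block 1 (X s)
  v₁ : ∀ t ∈ Set.Icc a b, block 1 (X t) = block 1 x
  v₂ : ∀ t ∈ Set.Icc a b,
    block 2 (X t) = block 2 x + ∫ s in a..t, (-(γ • block 1 (X s)) + γ • block 3 x)
  v₃ : ∀ t ∈ Set.Icc a b,
    block 3 (X t) = block 3 x + (∫ s in a..t, (-(γ • block 2 (X s)) - γ • block 3 (X s)))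
      + √(2 * γ) • (w t - w a)

/-- `X` is, on `[a, b]`, the path of a later stage started at `x` and driven by `w`, where `Y` is
the path of the preceding stage and `G` is the field that replaces `∇U`:
`dθ = v₁ dt`, `dv₁ = (-G(θ^Y) + γ v₂^Y) dt`, `dv₂ = (-γ v₁ + γ v₃^Y) dt`,
`dv₃ = (-γ v₂ - γ v₃) dt + √(2γ) dw`. -/
structure SolvesNextStage {d : ℕ} (G : Vec d → Vec d) (γ a b : ℝ) (w : ℝ → Vec d) (x : Phase d)
    (Y X : ℝ → Phase d) : Prop where
  continuousOn : ContinuousOn X (Set.Icc a b)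
  theta : ∀ t ∈ Set.Icc a b,
    block 0 (X t) = block 0 x + ∫ s in a..t, block 1 (X s)
  v₁ : ∀ t ∈ Set.Icc a b,
    block 1 (X t) = block 1 x + ∫ s in a..t, (-(G (block 0 (Y s))) + γ • block 2 (Y s))
  v₂ : ∀ t ∈ Set.Icc a b,
    block 2 (X t) = block 2 x + ∫ s in a..t, (-(γ • block 1 (X s)) + γ • block 3 (Y s))
  v₃ : ∀ t ∈ Set.Icc a b,
    block 3 (X t) = block 3 x + (∫ s in a..t, (-(γ • block 2 (X s)) - γ • block 3 (X s)))
      + √(2 * γ) • (w t - w a)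

/-- The iterates `x k` of the fourth-order scheme with step size `η`, with the stage processes
`xhat k`, `xtilde k`, `xbar k` on `[kη, (k+1)η]`, all driven by the same Brownian motion `B`.
The starting point `x 0` is an arbitrary random vector independent of `B`. -/
structure IsFourthOrderScheme {Ω : Type*} [MeasurableSpace Ω] {d : ℕ} (U : Vec d → ℝ) (α : ℕ)
    (γ η : ℝ) (B : ℝ≥0 → Ω → Vec d) (P : Measure Ω) (x : ℕ → Ω → Phase d)
    (xhat xtilde xbar : ℕ → ℝ → Ω → Phase d) : Prop where
  measurable_init : Measurable (x 0)
  indep_init : IndepFun (x 0) (fun (ω : Ω) (t : ℝ≥0) => B t ω) P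
  stage_one : ∀ k : ℕ, ∀ᵐ ω ∂P,
    SolvesFirstStage γ (k * η) ((k + 1) * η) (fun t => B t.toNNReal ω) (x k ω)
      (fun t => xhat k t ω)
  stage_two : ∀ k : ℕ, ∀ᵐ ω ∂P,
    SolvesNextStage (gradTaylor U α) γ (k * η) ((k + 1) * η) (fun t => B t.toNNReal ω) (x k ω)
      (fun t => xhat k t ω) (fun t => xtilde k t ω)
  stage_three : ∀ k : ℕ, ∀ᵐ ω ∂P,
    SolvesNextStage (gradTaylor U α) γ (k * η) ((k + 1) * η) (fun t => B t.toNNReal ω) (x k ω)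
      (fun t => xtilde k t ω) (fun t => xbar k t ω)
  next : ∀ k : ℕ, ∀ᵐ ω ∂P, x (k + 1) ω = xbar k ((k + 1) * η) ω

/-- `g̃` at time `r` after the beginning of the step. -/
def gTilde {d : ℕ} (U : Vec d → ℝ) (α : ℕ) (x : Phase d) (r : ℝ) : Vec d :=
  gradTaylor U α (block 0 x + r • block 1 x)

/-- `θ̃` at time `r` after the beginning of the step. -/
def thetaTilde {d : ℕ} (U : Vec d → ℝ) (α : ℕ) (γ : ℝ) (x : Phase d) (r : ℝ) : Vec d :=
  block 0 x + r • block 1 x - (∫ s in (0 : ℝ)..r, ∫ q in (0 : ℝ)..s, gTilde U α x q)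
    + (γ * r ^ 2 / 2) • block 2 x + (γ ^ 2 * r ^ 3 / 6) • (block 3 x - block 1 x)

/-- `ḡ` at time `r` after the beginning of the step. -/
def gBar {d : ℕ} (U : Vec d → ℝ) (α : ℕ) (γ : ℝ) (x : Phase d) (r : ℝ) : Vec d :=
  gradTaylor U α (thetaTilde U α γ x r)

/-- The constants `μ_{ij}`. -/
def muCoeff (γ η : ℝ) : Matrix (Fin 4) (Fin 4) ℝ :=
  let s := γ * η
  let e := Real.exp (-(γ * η))
  !![1,
      (1 + s ^ 2 / 2 - s ^ 3 / 3 + s ^ 4 / 24 + s ^ 5 / 120 - e) / γ,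
      (1 - s + s ^ 2 - s ^ 3 / 6 - s ^ 4 / 24 - e) / γ,
      (s ^ 3 / 6 - s ^ 4 / 24 - s ^ 5 / 120) / γ;
    0,
      s - s ^ 2 + s ^ 3 / 6 + s ^ 4 / 24 + e,
      -1 + 2 * s - s ^ 2 / 2 - s ^ 3 / 6 + e,
      s ^ 2 / 2 - s ^ 3 / 6 - s ^ 4 / 24;
    0,
      3 - 3 * s + s ^ 2 / 2 + s ^ 3 / 3 - s ^ 4 / 12 - s ^ 5 / 120 - (3 + s) * e,
      3 - s - s ^ 2 + s ^ 3 / 3 + s ^ 4 / 24 - (2 + s) * e,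
      s - s ^ 2 / 2 - s ^ 3 / 6 + s ^ 4 / 12 + s ^ 5 / 120;
    0,
      -4 + s + s ^ 2 - s ^ 3 / 2 + s ^ 4 / 24 + s ^ 5 / 120 + (4 + 3 * s + s ^ 2 / 2) * e,
      -1 - 2 * s + 3 * s ^ 2 / 2 - s ^ 3 / 6 - s ^ 4 / 24 + (1 + 2 * s + s ^ 2 / 2) * e,
      -(s ^ 2 / 2) + s ^ 3 / 3 - s ^ 4 / 24 - s ^ 5 / 120 + e]

/-- The contribution of the gradient polynomials `g̃`, `ḡ` to the `i`-th block of the mean. -/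
def gradPart {d : ℕ} (U : Vec d → ℝ) (α : ℕ) (γ η : ℝ) (x : Phase d) : Fin 4 → Vec d :=
  ![-(∫ r in (0 : ℝ)..η, (η - r) • gBar U α γ x r)
      + ∫ r in (0 : ℝ)..η, (γ ^ 2 * (η - r) ^ 3 / 6) • gTilde U α x r,
    -(∫ r in (0 : ℝ)..η, gBar U α γ x r)
      + ∫ r in (0 : ℝ)..η, (γ ^ 2 * (η - r) ^ 2 / 2) • gTilde U α x r,
    (∫ r in (0 : ℝ)..η, (γ * (η - r)) • gBar U α γ x r)
      - ∫ r in (0 : ℝ)..η, ((γ * (η - r)) ^ 3 / 6 + (γ * (η - r)) ^ 2 / 2 - γ * (η - r) + 1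
          - Real.exp (-(γ * (η - r)))) • gTilde U α x r,
    -(∫ r in (0 : ℝ)..η, (γ * (η - r) - 1 + Real.exp (-(γ * (η - r)))) • gBar U α γ x r)
      + ∫ r in (0 : ℝ)..η, ((γ * (η - r)) ^ 3 / 6 - γ * (η - r) + 2
          - (2 + γ * (η - r)) * Real.exp (-(γ * (η - r)))) • gTilde U α x r]

/-- The mean vector `M(x)`, with blocks `m₀, m₁, m₂, m₃`. -/
def meanVec {d : ℕ} (U : Vec d → ℝ) (α : ℕ) (γ η : ℝ) (x : Phase d) : Phase d :=
  assemble fun i => gradPart U α γ η x i + ∑ j : Fin 4, muCoeff γ η i j • block j x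

/-- The constants `σ_{ij}` with `i ≤ j`. -/
def sigmaUpper (γ η : ℝ) : Matrix (Fin 4) (Fin 4) ℝ :=
  let s := γ * η
  let e := Real.exp (-(γ * η))
  !![(-3 + 2 * s - 2 * s ^ 2 + 4 * s ^ 3 / 3 - s ^ 4 / 2 + s ^ 5 / 10
        + (4 + 2 * s ^ 2) * e - e ^ 2) / γ ^ 2,
      (1 - 2 * s + 2 * s ^ 2 - s ^ 3 + s ^ 4 / 4 + (-2 + 2 * s - s ^ 2) * e + e ^ 2) / γ,
      (-15 / 2 + 4 * s - 2 * s ^ 2 + s ^ 3 / 3 + s ^ 4 / 4 - s ^ 5 / 10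
        + (10 + 2 * s + 2 * s ^ 2 + s ^ 3) * e + (-5 / 2 - s) * e ^ 2) / γ,
      (75 / 4 - 2 * s + 2 * s ^ 3 / 3 - s ^ 4 / 2 + s ^ 5 / 10
        + (-22 - 16 * s - 7 * s ^ 2 - 3 * s ^ 3 - s ^ 4 / 2) * e
        + (13 / 4 + 5 * s / 2 + s ^ 2 / 2) * e ^ 2) / γ;
    0,
      1 + 2 * s - 2 * s ^ 2 + 2 * s ^ 3 / 3 - 4 * s * e - e ^ 2,
      -5 / 2 - 4 * s + 2 * s ^ 2 + s ^ 3 / 3 - s ^ 4 / 4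
        + (8 * s + 3 * s ^ 2) * e + (5 / 2 + s) * e ^ 2,
      37 / 4 + 2 * s - s ^ 3 + s ^ 4 / 4
        + (-6 - 12 * s - 7 * s ^ 2 - s ^ 3) * e
        + (-13 / 4 - 5 * s / 2 - s ^ 2 / 2) * e ^ 2;
    0,
      0,
      5 / 2 + 8 * s - 4 * s ^ 3 / 3 + s ^ 5 / 10
        + (4 - 12 * s - 10 * s ^ 2 - 2 * s ^ 3) * e
        + (-13 / 2 - 5 * s - s ^ 2) * e ^ 2,
      -103 / 8 - 4 * s - 2 * s ^ 2 + s ^ 3 + s ^ 4 / 4 - s ^ 5 / 10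
        + (4 + 16 * s + 15 * s ^ 2 + 5 * s ^ 3 + s ^ 4 / 2) * e
        + (71 / 8 + 39 * s / 4 + 15 * s ^ 2 / 4 + s ^ 3 / 2) * e ^ 2;
    0,
      0,
      0,
      103 / 8 + 2 * s + 2 * s ^ 2 - s ^ 4 / 2 + s ^ 5 / 10
        + (-8 * s - 12 * s ^ 2 - 6 * s ^ 3 - s ^ 4) * e
        + (-103 / 8 - 71 * s / 4 - 39 * s ^ 2 / 4 - 5 * s ^ 3 / 2 - s ^ 4 / 4) * e ^ 2]

/-- The symmetric matrix `(σ_{ij})`. -/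
def sigmaCoeff (γ η : ℝ) : Matrix (Fin 4) (Fin 4) ℝ :=
  Matrix.of fun i j => sigmaUpper γ η (min i j) (max i j)

/-- The covariance matrix `Σ = (σ_{ij} I_d)`. -/
def covMat (d : ℕ) (γ η : ℝ) : Matrix (Fin 4 × Fin d) (Fin 4 × Fin d) ℝ :=
  sigmaCoeff γ η ⊗ₖ (1 : Matrix (Fin d) (Fin d) ℝ)

end FourthLMC

end

namespace FourthLMC

/-! ### Continuity of the blocks and of the Taylor polynomial -/

/-! Along a fixed Brownian path the three stages form a linear system, apart from the gradient
terms, with additive noise, so a step is solved by duality. Each block of the end point is paired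
with weights solving the adjoint linear equation backwards in time (`AdjointSolution`). Subtracting
the scaled Brownian path from every `v₃` leaves differentiable functions, so ordinary calculus
suffices. In the derivative of the pairing all linear terms cancel, and only the gradient terms and
a multiple of the path survive (`adjoint_identity`).

In the first stage `v₃` is frozen in the equation of `v₂`, so the noise reaches neither `θ` nor `v₁`
of the first two stages. Both gradient arguments are therefore explicit functions of the starting
point, and the end point is `meanVec` plus a noise vector (`step_eq`). The noise in block `i` is the
Wiener integral `√(2γ) ∫ K_i(η - r) dB_r`, written after integration by parts, where `K_i` is the
sum of the adjoint weights of `v₃` over the three stages.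

The noise is Gaussian because its characteristic function is the limit of those of Riemann sums of
independent increments (`integral_exp_sum_wienerIntegral`). Its covariance is `2γ ∫₀^η K_i K_j`
times the identity; the closed forms `σ_{ij}` vanish at `η = 0` and have derivative `2γ K_i K_j`
(`hasDerivAt_sigmaUpper`).

Finally, `x k` agrees almost surely with a function of the initial value and the path up to time
`kη`, while the noise of the next step depends only on later increments. The two are independent,
and the conditional law is the noise law translated by the mean
(`condDistrib_ae_eq_map_of_indepFun`). -/

@[fun_prop]
lemma continuous_block {d : ℕ} (i : Fin 4) : Continuous (block (d := d) i) := by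
  unfold block; fun_prop

@[fun_prop]
lemma continuous_assemble {d : ℕ} : Continuous (assemble (d := d)) := by
  unfold assemble; fun_prop

lemma assemble_block {d : ℕ} (x : Phase d) : assemble (fun i => block i x) = x := by
  ext p; simp [assemble, block]

@[fun_prop]
lemma continuous_gradTaylor {d : ℕ} (U : Vec d → ℝ) (α : ℕ) : Continuous (gradTaylor U α) := by
  unfold gradTaylor
  refine continuous_finsetSum _ fun j _ => ?_
  have h : Continuous fun x : Vec d => iteratedFDeriv ℝ j (gradient U) 0 fun _ => x :=
    (iteratedFDeriv ℝ j (gradient U) 0).cont.comp (continuous_pi fun _ => continuous_id)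
  exact h.const_smul ((j.factorial : ℝ)⁻¹)

lemma continuous_gTilde_uncurry {d : ℕ} (U : Vec d → ℝ) (α : ℕ) :
    Continuous fun p : Phase d × ℝ => gTilde U α p.1 p.2 := by
  unfold gTilde; fun_prop

@[fun_prop]
lemma continuous_gTilde {d : ℕ} (U : Vec d → ℝ) (α : ℕ) (x : Phase d) :
    Continuous (gTilde U α x) := by
  unfold gTilde; fun_prop

/-- Continuity is joint in the parameter and the upper limit, so that the statement can be iterated
for the double integral in `thetaTilde`. The aim is continuity, hence measurability, of `meanVec` in
the starting point. -/
lemma continuous_integral_upper {X E : Type*} [TopologicalSpace X] [FirstCountableTopology X]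
    [NormedAddCommGroup E] [NormedSpace ℝ E] {g : X → ℝ → E}
    (hg : Continuous fun p : X × ℝ => g p.1 p.2) :
    Continuous fun p : X × ℝ => ∫ q in (0 : ℝ)..p.2, g p.1 q := by
  refine intervalIntegral.continuous_parametric_intervalIntegral_of_continuous
    (f := fun p : X × ℝ => g p.1) ?_ continuous_snd
  exact hg.comp ((continuous_fst.comp continuous_fst).prodMk continuous_snd)

lemma continuous_thetaTilde_uncurry {d : ℕ} (U : Vec d → ℝ) (α : ℕ) (γ : ℝ) :
    Continuous fun p : Phase d × ℝ => thetaTilde U α γ p.1 p.2 := by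
  have h1 := continuous_integral_upper (continuous_gTilde_uncurry U α)
  have h2 := continuous_integral_upper
    (g := fun (x : Phase d) s => ∫ q in (0 : ℝ)..s, gTilde U α x q) h1
  unfold thetaTilde
  fun_prop

@[fun_prop]
lemma continuous_thetaTilde {d : ℕ} (U : Vec d → ℝ) (α : ℕ) (γ : ℝ) (x : Phase d) :
    Continuous (thetaTilde U α γ x) := by
  have h : Continuous fun r : ℝ => (x, r) := by fun_prop
  have := (continuous_thetaTilde_uncurry U α γ).comp h
  exact this

lemma continuous_gBar_uncurry {d : ℕ} (U : Vec d → ℝ) (α : ℕ) (γ : ℝ) :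
    Continuous fun p : Phase d × ℝ => gBar U α γ p.1 p.2 :=
  (continuous_gradTaylor U α).comp (continuous_thetaTilde_uncurry U α γ)

@[fun_prop]
lemma continuous_gBar {d : ℕ} (U : Vec d → ℝ) (α : ℕ) (γ : ℝ) (x : Phase d) :
    Continuous (gBar U α γ x) :=
  (continuous_gradTaylor U α).comp (continuous_thetaTilde U α γ x)

lemma continuous_integral_smul {X E : Type*} [TopologicalSpace X] [FirstCountableTopology X]
    [NormedAddCommGroup E] [NormedSpace ℝ E] {g : X → ℝ → E}
    (hg : Continuous fun p : X × ℝ => g p.1 p.2) {f : ℝ → ℝ} (hf : Continuous f) (a b : ℝ) :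
    Continuous fun x => ∫ r in a..b, f r • g x r := by
  refine intervalIntegral.continuous_parametric_intervalIntegral_of_continuous'
    (f := fun x r => f r • g x r) ?_ a b
  exact (hf.comp continuous_snd).smul hg

@[fun_prop]
lemma continuous_meanVec {d : ℕ} (U : Vec d → ℝ) (α : ℕ) (γ η : ℝ) :
    Continuous (meanVec U α γ η) := by
  have hg {f : ℝ → ℝ} (hf : Continuous f) :
      Continuous fun x : Phase d => ∫ r in (0 : ℝ)..η, f r • gTilde U α x r :=
    continuous_integral_smul (continuous_gTilde_uncurry U α) hf 0 η
  have hb {f : ℝ → ℝ} (hf : Continuous f) :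
      Continuous fun x : Phase d => ∫ r in (0 : ℝ)..η, f r • gBar U α γ x r :=
    continuous_integral_smul (continuous_gBar_uncurry U α γ) hf 0 η
  have hb1 : Continuous fun x : Phase d => ∫ r in (0 : ℝ)..η, gBar U α γ x r := by
    simpa using hb (continuous_const (y := 1))
  refine continuous_assemble.comp (continuous_pi fun i => Continuous.add ?_ (by fun_prop))
  fin_cases i
  · exact (hb (by fun_prop)).neg.add (hg (by fun_prop))
  · exact hb1.neg.add (hg (by fun_prop))
  · exact (hb (by fun_prop)).sub (hg (by fun_prop))
  · exact (hb (by fun_prop)).neg.add (hg (by fun_prop))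

/-! ### The stage equations along a path -/

/-- Turns the integrated equations into differential ones. Interior points are enough, since the
fundamental theorem of calculus used later needs only continuity at the end points. -/
lemma hasDerivAt_of_eq_add_integral {E : Type*} [NormedAddCommGroup E] [NormedSpace ℝ E]
    [CompleteSpace E] {a b : ℝ} {y F : ℝ → E} {c : E} (hF : ContinuousOn F (Set.Icc a b))
    (h : ∀ t ∈ Set.Icc a b, y t = c + ∫ s in a..t, F s) {t : ℝ} (ht : t ∈ Set.Ioo a b) :
    HasDerivAt y (F t) t := by
  have hnhds : Set.Icc a b ∈ nhds t := Icc_mem_nhds ht.1 ht.2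
  have hint : IntervalIntegrable F volume a t :=
    (hF.mono (by rw [Set.uIcc_of_le ht.1.le]; exact Set.Icc_subset_Icc_right ht.2.le)
      ).intervalIntegrable
  have hm : StronglyMeasurableAtFilter F (nhds t) volume :=
    ContinuousOn.stronglyMeasurableAtFilter isOpen_Ioo (hF.mono Set.Ioo_subset_Icc_self) t ht
  have := (intervalIntegral.integral_hasDerivAt_right hint hm (hF.continuousAt hnhds)).const_add c
  refine this.congr_of_eventuallyEq ?_
  filter_upwards [hnhds] with s hs using h s hs

/-- Solutions of the equation adjoint to the linear part of the three coupled stages, as functions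
of the time that remains. The letters `b`, `t`, `h` refer to the third, second and first stage, the
subscripts to the components `θ, v₁, v₂, v₃`, and `c` to the constant `v₃ - v₁`. -/
structure AdjointSolution (γ : ℝ) where
  /-- The weight of the position. -/
  b₀ : ℝ → ℝ
  /-- The weight of `v₁` in the third stage. -/
  b₁ : ℝ → ℝ
  /-- The weight of `v₂` in the third stage. -/
  b₂ : ℝ → ℝ
  /-- The weight of `v₃` in the third stage. -/
  b₃ : ℝ → ℝ
  /-- The weight of `v₁` in the second stage. -/
  t₁ : ℝ → ℝ
  /-- The weight of `v₂` in the second stage. -/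
  t₂ : ℝ → ℝ
  /-- The weight of `v₃` in the second stage. -/
  t₃ : ℝ → ℝ
  /-- The weight of `v₂` in the first stage. -/
  h₂ : ℝ → ℝ
  /-- The weight of `v₃` in the first stage. -/
  h₃ : ℝ → ℝ
  /-- The weight of the constant `v₃ - v₁`. -/
  c : ℝ → ℝ
  deriv_b₀ : ∀ u, HasDerivAt b₀ 0 u
  deriv_b₁ : ∀ u, HasDerivAt b₁ (b₀ u - γ * b₂ u) u
  deriv_b₂ : ∀ u, HasDerivAt b₂ (-(γ * b₃ u)) u
  deriv_b₃ : ∀ u, HasDerivAt b₃ (-(γ * b₃ u)) u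
  deriv_t₁ : ∀ u, HasDerivAt t₁ (-(γ * t₂ u)) u
  deriv_t₂ : ∀ u, HasDerivAt t₂ (γ * b₁ u - γ * t₃ u) u
  deriv_t₃ : ∀ u, HasDerivAt t₃ (γ * b₂ u - γ * t₃ u) u
  deriv_h₂ : ∀ u, HasDerivAt h₂ (γ * t₁ u - γ * h₃ u) u
  deriv_h₃ : ∀ u, HasDerivAt h₃ (γ * t₂ u - γ * h₃ u) u
  deriv_c : ∀ u, HasDerivAt c (γ * h₂ u) u
  t₁_zero : t₁ 0 = 0
  t₂_zero : t₂ 0 = 0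
  t₃_zero : t₃ 0 = 0
  h₂_zero : h₂ 0 = 0
  h₃_zero : h₃ 0 = 0
  c_zero : c 0 = 0

namespace AdjointSolution

variable {γ : ℝ} (p : AdjointSolution γ)

/-- The kernel against which the noise is integrated. -/
def kernel (u : ℝ) : ℝ := p.b₃ u + p.t₃ u + p.h₃ u

/-- The derivative of the noise kernel. -/
def kernel' (u : ℝ) : ℝ := γ * (p.b₂ u + p.t₂ u) - γ * p.kernel u

lemma hasDerivAt_kernel (u : ℝ) : HasDerivAt p.kernel (p.kernel' u) u := by
  refine (((p.deriv_b₃ u).add (p.deriv_t₃ u)).add (p.deriv_h₃ u)).congr_deriv ?_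
  simp only [kernel', kernel]; ring

lemma continuous_kernel : Continuous p.kernel :=
  continuous_iff_continuousAt.2 fun u => (p.hasDerivAt_kernel u).continuousAt

lemma continuous_kernel' : Continuous p.kernel' := by
  have h2 : Continuous p.b₂ := continuous_iff_continuousAt.2 fun u => (p.deriv_b₂ u).continuousAt
  have h3 : Continuous p.t₂ := continuous_iff_continuousAt.2 fun u => (p.deriv_t₂ u).continuousAt
  have := p.continuous_kernel
  unfold kernel'
  fun_prop

end AdjointSolution

variable {d : ℕ}

/-- Pairing the three stages with a solution of the adjoint equation. -/
lemma adjoint_identity {γ a b : ℝ} (hab : a ≤ b) {G : Vec d → Vec d} (hG : Continuous G)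
    {w : ℝ → Vec d} (hw : ContinuousOn w (Set.Icc a b)) {x : Phase d} {X₁ X₂ X₃ : ℝ → Phase d}
    (h₁ : SolvesFirstStage γ a b w x X₁) (h₂ : SolvesNextStage G γ a b w x X₁ X₂)
    (h₃ : SolvesNextStage G γ a b w x X₂ X₃) (p : AdjointSolution γ) :
    p.b₀ 0 • block 0 (X₃ b) + p.b₁ 0 • block 1 (X₃ b) + p.b₂ 0 • block 2 (X₃ b)
        + p.b₃ 0 • block 3 (X₃ b)
      = p.b₀ (b - a) • block 0 x + (p.b₁ (b - a) + p.t₁ (b - a) - p.c (b - a)) • block 1 x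
        + (p.b₂ (b - a) + p.t₂ (b - a) + p.h₂ (b - a)) • block 2 x
        + (p.kernel (b - a) + p.c (b - a)) • block 3 x
        - (∫ t in a..b, p.b₁ (b - t) • G (block 0 (X₂ t)))
        - (∫ t in a..b, p.t₁ (b - t) • G (block 0 (X₁ t)))
        + √(2 * γ) • (p.kernel 0 • (w b - w a) + ∫ t in a..b, p.kernel' (b - t) • (w t - w a)) := by
  have c₁ := h₁.continuousOn
  have c₂ := h₂.continuousOn
  have c₃ := h₃.continuousOn
  have B₁ (i) : ContinuousOn (fun t => block i (X₁ t)) (Set.Icc a b) :=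
    (continuous_block i).comp_continuousOn c₁
  have B₂ (i) : ContinuousOn (fun t => block i (X₂ t)) (Set.Icc a b) :=
    (continuous_block i).comp_continuousOn c₂
  have B₃ (i) : ContinuousOn (fun t => block i (X₃ t)) (Set.Icc a b) :=
    (continuous_block i).comp_continuousOn c₃
  -- The path is not differentiable, but each `v₃ - W` is, because the noise is additive.
  set W : ℝ → Vec d := fun t => √(2 * γ) • (w t - w a) with hW
  have hWc : ContinuousOn W (Set.Icc a b) := by fun_prop
  have ha : a ∈ Set.Icc a b := ⟨le_rfl, hab⟩
  have hb : b ∈ Set.Icc a b := ⟨hab, le_rfl⟩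
  have hWa : W a = 0 := by simp [hW]
  -- The positions of the first two stages get no weight, as they enter only through `G`. The frozen
  -- `v₁` of the first stage is absorbed in the constant `v₃ - v₁`, whose weight `c` compensates the
  -- drift of `v₂` there.
  let Φ : ℝ → Vec d := fun t =>
    p.b₀ (b - t) • block 0 (X₃ t) + p.b₁ (b - t) • block 1 (X₃ t) + p.b₂ (b - t) • block 2 (X₃ t)
      + p.b₃ (b - t) • (block 3 (X₃ t) - W t)
      + p.t₁ (b - t) • block 1 (X₂ t) + p.t₂ (b - t) • block 2 (X₂ t)
      + p.t₃ (b - t) • (block 3 (X₂ t) - W t)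
      + p.h₂ (b - t) • block 2 (X₁ t) + p.h₃ (b - t) • (block 3 (X₁ t) - W t)
      + p.c (b - t) • (block 3 x - block 1 x)
  have rev {f : ℝ → ℝ} {f' : ℝ → ℝ} (hf : ∀ u, HasDerivAt f (f' u) u) (t : ℝ) :
      HasDerivAt (fun t => f (b - t)) (-f' (b - t)) t := by
    have := (hf (b - t)).comp t ((hasDerivAt_id t).const_sub b)
    simpa [Function.comp_def] using this
  have revc {f : ℝ → ℝ} {f' : ℝ → ℝ} (hf : ∀ u, HasDerivAt f (f' u) u) :
      Continuous fun t => f (b - t) :=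
    continuous_iff_continuousAt.2 fun t => (rev hf t).continuousAt
  have R₀ := revc p.deriv_b₀
  have R₁ := revc p.deriv_b₁
  have R₂ := revc p.deriv_b₂
  have R₃ := revc p.deriv_b₃
  have S₁ := revc p.deriv_t₁
  have S₂ := revc p.deriv_t₂
  have S₃ := revc p.deriv_t₃
  have Q₂ := revc p.deriv_h₂
  have Q₃ := revc p.deriv_h₃
  have Qc := revc p.deriv_c
  have Kc : Continuous fun t => p.kernel' (b - t) :=
    p.continuous_kernel'.comp (continuous_const.sub continuous_id)
  have hΦc : ContinuousOn Φ (Set.Icc a b) := by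
    exact (((((((((R₀.continuousOn.smul (B₃ 0)).add (R₁.continuousOn.smul (B₃ 1))).add
      (R₂.continuousOn.smul (B₃ 2))).add (R₃.continuousOn.smul ((B₃ 3).sub hWc))).add
      (S₁.continuousOn.smul (B₂ 1))).add (S₂.continuousOn.smul (B₂ 2))).add
      (S₃.continuousOn.smul ((B₂ 3).sub hWc))).add (Q₂.continuousOn.smul (B₁ 2))).add
      (Q₃.continuousOn.smul ((B₁ 3).sub hWc))).add (Qc.continuousOn.smul continuousOn_const)
  -- The adjoint equations cancel every linear term in the blocks. The `W` term remains because the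
  -- drifts contain `v₃` whereas `Φ` contains `v₃ - W`; its coefficient is the derivative of `b₃ +
  -- t₃ + h₃`.
  have hΦ : ∀ t ∈ Set.Ioo a b, HasDerivAt Φ
      (-(p.b₁ (b - t) • G (block 0 (X₂ t))) - p.t₁ (b - t) • G (block 0 (X₁ t))
        + p.kernel' (b - t) • W t) t := by
    intro t ht
    have e0 := hasDerivAt_of_eq_add_integral (B₃ 1) h₃.theta ht
    have e1 := hasDerivAt_of_eq_add_integral (F := fun s => -(G (block 0 (X₂ s))) + γ • block 2 (X₂ s))
      ((hG.comp_continuousOn (B₂ 0)).neg.add ((B₂ 2).const_smul γ)) h₃.v₁ ht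
    have e2 := hasDerivAt_of_eq_add_integral (F := fun s => -(γ • block 1 (X₃ s)) + γ • block 3 (X₂ s))
      (((B₃ 1).const_smul γ).neg.add ((B₂ 3).const_smul γ)) h₃.v₂ ht
    have e3 := hasDerivAt_of_eq_add_integral (y := fun t => block 3 (X₃ t) - W t)
      (F := fun s => -(γ • block 2 (X₃ s)) - γ • block 3 (X₃ s)) (c := block 3 x)
      (((B₃ 2).const_smul γ).neg.sub ((B₃ 3).const_smul γ))
      (fun t ht => by rw [h₃.v₃ t ht]; simp [hW]) ht
    have f1 := hasDerivAt_of_eq_add_integral (F := fun s => -(G (block 0 (X₁ s))) + γ • block 2 (X₁ s))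
      ((hG.comp_continuousOn (B₁ 0)).neg.add ((B₁ 2).const_smul γ)) h₂.v₁ ht
    have f2 := hasDerivAt_of_eq_add_integral (F := fun s => -(γ • block 1 (X₂ s)) + γ • block 3 (X₁ s))
      (((B₂ 1).const_smul γ).neg.add ((B₁ 3).const_smul γ)) h₂.v₂ ht
    have f3 := hasDerivAt_of_eq_add_integral (y := fun t => block 3 (X₂ t) - W t)
      (F := fun s => -(γ • block 2 (X₂ s)) - γ • block 3 (X₂ s)) (c := block 3 x)
      (((B₂ 2).const_smul γ).neg.sub ((B₂ 3).const_smul γ))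
      (fun t ht => by rw [h₂.v₃ t ht]; simp [hW]) ht
    have g2 := hasDerivAt_of_eq_add_integral (F := fun s => -(γ • block 1 (X₁ s)) + γ • block 3 x)
      (((B₁ 1).const_smul γ).neg.add continuousOn_const) h₁.v₂ ht
    have g3 := hasDerivAt_of_eq_add_integral (y := fun t => block 3 (X₁ t) - W t)
      (F := fun s => -(γ • block 2 (X₁ s)) - γ • block 3 (X₁ s)) (c := block 3 x)
      (((B₁ 2).const_smul γ).neg.sub ((B₁ 3).const_smul γ))
      (fun t ht => by rw [h₁.v₃ t ht]; simp [hW]) ht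
    have key := ((((((((((rev p.deriv_b₀ t).smul e0).add ((rev p.deriv_b₁ t).smul e1)).add
      ((rev p.deriv_b₂ t).smul e2)).add ((rev p.deriv_b₃ t).smul e3)).add
      ((rev p.deriv_t₁ t).smul f1)).add ((rev p.deriv_t₂ t).smul f2)).add
      ((rev p.deriv_t₃ t).smul f3)).add ((rev p.deriv_h₂ t).smul g2)).add
      ((rev p.deriv_h₃ t).smul g3)).add ((rev p.deriv_c t).smul_const (block 3 x - block 1 x))
    refine key.congr_deriv ?_
    rw [h₁.v₁ t (Set.Ioo_subset_Icc_self ht)]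
    simp only [AdjointSolution.kernel', AdjointSolution.kernel]
    module
  have I₁ : IntervalIntegrable (fun t => p.b₁ (b - t) • G (block 0 (X₂ t))) volume a b := by
    refine ContinuousOn.intervalIntegrable ?_
    rw [Set.uIcc_of_le hab]; exact R₁.continuousOn.smul (hG.comp_continuousOn (B₂ 0))
  have I₂ : IntervalIntegrable (fun t => p.t₁ (b - t) • G (block 0 (X₁ t))) volume a b := by
    refine ContinuousOn.intervalIntegrable ?_
    rw [Set.uIcc_of_le hab]; exact S₁.continuousOn.smul (hG.comp_continuousOn (B₁ 0))
  have I₃ : IntervalIntegrable (fun t => p.kernel' (b - t) • W t) volume a b := by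
    refine ContinuousOn.intervalIntegrable ?_
    rw [Set.uIcc_of_le hab]; exact Kc.continuousOn.smul hWc
  have N₁ : IntervalIntegrable (fun t => -(p.b₁ (b - t) • G (block 0 (X₂ t)))) volume a b := I₁.neg
  have ftc := intervalIntegral.integral_eq_sub_of_hasDerivAt_of_le hab hΦc hΦ
    ((N₁.sub I₂).add I₃)
  rw [intervalIntegral.integral_add (N₁.sub I₂) I₃, intervalIntegral.integral_sub N₁ I₂,
    intervalIntegral.integral_neg] at ftc
  have hWint : ∫ t in a..b, p.kernel' (b - t) • W t
      = √(2 * γ) • ∫ t in a..b, p.kernel' (b - t) • (w t - w a) := by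
    rw [← intervalIntegral.integral_smul]
    simp only [hW, smul_comm (√(2 * γ))]
  -- No time remains at `b`, and the weights of the first two stages vanish there, so only the third
  -- stage is seen.
  have hΦb : Φ b = p.b₀ 0 • block 0 (X₃ b) + p.b₁ 0 • block 1 (X₃ b) + p.b₂ 0 • block 2 (X₃ b)
      + p.b₃ 0 • block 3 (X₃ b) - p.kernel 0 • W b := by
    simp only [Φ, sub_self, p.t₁_zero, p.t₂_zero, p.t₃_zero, p.h₂_zero, p.h₃_zero, p.c_zero,
      AdjointSolution.kernel]
    module
  -- All three stages start at `x`, so the weights of a given block add up.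
  have hΦa : Φ a = p.b₀ (b - a) • block 0 x
      + (p.b₁ (b - a) + p.t₁ (b - a) - p.c (b - a)) • block 1 x
      + (p.b₂ (b - a) + p.t₂ (b - a) + p.h₂ (b - a)) • block 2 x
      + (p.kernel (b - a) + p.c (b - a)) • block 3 x := by
    have e1 := h₁.v₂ a ha; have e2 := h₁.v₃ a ha; have e3 := h₂.v₁ a ha
    have e4 := h₂.v₂ a ha; have e5 := h₂.v₃ a ha; have e6 := h₃.theta a ha
    have e7 := h₃.v₁ a ha; have e8 := h₃.v₂ a ha; have e9 := h₃.v₃ a ha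
    simp only [intervalIntegral.integral_same, sub_self, smul_zero, add_zero] at e1 e2 e3 e4 e5 e6 e7 e8 e9
    simp only [Φ, hWa, e1, e2, e3, e4, e5, e6, e7, e8, e9, AdjointSolution.kernel]
    module
  rw [hWint, hΦa, hΦb] at ftc
  rw [eq_comm, sub_eq_iff_eq_add, sub_eq_iff_eq_add] at ftc
  rw [ftc]
  simp only [hW]
  module

/-! ### Noise-free components of the first two stages -/

lemma first_stage_theta {γ a b : ℝ} {w : ℝ → Vec d} {x : Phase d} {X : ℝ → Phase d}
    (h : SolvesFirstStage γ a b w x X) {t : ℝ} (ht : t ∈ Set.Icc a b) :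
    block 0 (X t) = block 0 x + (t - a) • block 1 x := by
  rw [h.theta t ht, intervalIntegral.integral_congr (g := fun _ => block 1 x)]
  · simp
  · intro s hs
    rw [Set.uIcc_of_le ht.1] at hs
    exact h.v₁ s ⟨hs.1, hs.2.trans ht.2⟩

lemma first_stage_v₂ {γ a b : ℝ} {w : ℝ → Vec d} {x : Phase d} {X : ℝ → Phase d}
    (h : SolvesFirstStage γ a b w x X) {t : ℝ} (ht : t ∈ Set.Icc a b) :
    block 2 (X t) = block 2 x + ((t - a) * γ) • (block 3 x - block 1 x) := by
  rw [h.v₂ t ht, intervalIntegral.integral_congr (g := fun _ => -(γ • block 1 x) + γ • block 3 x)]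
  · simp only [intervalIntegral.integral_const]
    module
  · intro s hs
    rw [Set.uIcc_of_le ht.1] at hs
    simp only [h.v₁ s ⟨hs.1, hs.2.trans ht.2⟩]

/-- The velocity `ṽ₁` at time `r` after the beginning of the step. -/
noncomputable def velocityTilde (U : Vec d → ℝ) (α : ℕ) (γ : ℝ) (x : Phase d) (r : ℝ) : Vec d :=
  block 1 x - (∫ q in (0 : ℝ)..r, gTilde U α x q) + (γ * r) • block 2 x
    + (γ ^ 2 * r ^ 2 / 2) • (block 3 x - block 1 x)

lemma hasDerivAt_velocityTilde (U : Vec d → ℝ) (α : ℕ) (γ : ℝ) (x : Phase d) (r : ℝ) :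
    HasDerivAt (velocityTilde U α γ x)
      (-gTilde U α x r + γ • (block 2 x + (r * γ) • (block 3 x - block 1 x))) r := by
  have h1 : HasDerivAt (fun r => ∫ q in (0 : ℝ)..r, gTilde U α x q) (gTilde U α x r) r :=
    (continuous_gTilde U α x).integral_hasStrictDerivAt 0 r |>.hasDerivAt
  have h2 : HasDerivAt (fun r : ℝ => γ * r) γ r := by
    simpa using (hasDerivAt_id r).const_mul γ
  have h3 : HasDerivAt (fun r : ℝ => γ ^ 2 * r ^ 2 / 2) (γ ^ 2 * r) r := by
    refine (((hasDerivAt_pow 2 r).const_mul (γ ^ 2)).div_const 2).congr_deriv ?_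
    simp; ring
  refine (((h1.const_sub (block 1 x)).add (h2.smul_const (block 2 x))).add
    (h3.smul_const (block 3 x - block 1 x))).congr_deriv ?_
  module

lemma hasDerivAt_thetaTilde (U : Vec d → ℝ) (α : ℕ) (γ : ℝ) (x : Phase d) (r : ℝ) :
    HasDerivAt (thetaTilde U α γ x) (velocityTilde U α γ x r) r := by
  have h0 : Continuous fun s : ℝ => ∫ q in (0 : ℝ)..s, gTilde U α x q :=
    continuous_iff_continuousAt.2 fun s =>
      ((continuous_gTilde U α x).integral_hasStrictDerivAt 0 s).hasDerivAt.continuousAt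
  have h1 := (h0.integral_hasStrictDerivAt 0 r).hasDerivAt
  have h2 : HasDerivAt (fun r : ℝ => γ * r ^ 2 / 2) (γ * r) r := by
    refine (((hasDerivAt_pow 2 r).const_mul γ).div_const 2).congr_deriv ?_
    simp; ring
  have h3 : HasDerivAt (fun r : ℝ => γ ^ 2 * r ^ 3 / 6) (γ ^ 2 * r ^ 2 / 2) r := by
    refine (((hasDerivAt_pow 3 r).const_mul (γ ^ 2)).div_const 6).congr_deriv ?_
    simp; ring
  refine ((((((hasDerivAt_id r).smul_const (block 1 x)).const_add (block 0 x)).sub h1).add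
    (h2.smul_const (block 2 x))).add (h3.smul_const (block 3 x - block 1 x))).congr_deriv ?_
  simp only [velocityTilde]
  module

@[fun_prop]
lemma continuous_velocityTilde (U : Vec d → ℝ) (α : ℕ) (γ : ℝ) (x : Phase d) :
    Continuous (velocityTilde U α γ x) :=
  continuous_iff_continuousAt.2 fun r => (hasDerivAt_velocityTilde U α γ x r).continuousAt

/-- The drift of this component involves only `θ` and `v₂` of the first stage, and both are free of
noise. Hence the gradient in the third stage is evaluated at a deterministic function of `x`. -/
lemma second_stage_v₁ {U : Vec d → ℝ} {α : ℕ} {γ a b : ℝ} {w : ℝ → Vec d} {x : Phase d}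
    {X₁ X₂ : ℝ → Phase d} (h₁ : SolvesFirstStage γ a b w x X₁)
    (h₂ : SolvesNextStage (gradTaylor U α) γ a b w x X₁ X₂) {t : ℝ} (ht : t ∈ Set.Icc a b) :
    block 1 (X₂ t) = velocityTilde U α γ x (t - a) := by
  have hd (s : ℝ) (_ : s ∈ Set.uIcc a t) := (hasDerivAt_velocityTilde U α γ x (s - a)).comp_sub_const s a
  rw [h₂.v₁ t ht, intervalIntegral.integral_congr (g := fun s => -gTilde U α x (s - a)
    + γ • (block 2 x + ((s - a) * γ) • (block 3 x - block 1 x))),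
    intervalIntegral.integral_eq_sub_of_hasDerivAt hd]
  · simp [velocityTilde]
  · exact Continuous.intervalIntegrable (by fun_prop) _ _
  · intro s hs
    rw [Set.uIcc_of_le ht.1] at hs
    have hs' : s ∈ Set.Icc a b := ⟨hs.1, hs.2.trans ht.2⟩
    simp only [first_stage_theta h₁ hs', first_stage_v₂ h₁ hs', gTilde]

lemma second_stage_theta {U : Vec d → ℝ} {α : ℕ} {γ a b : ℝ} {w : ℝ → Vec d} {x : Phase d}
    {X₁ X₂ : ℝ → Phase d} (h₁ : SolvesFirstStage γ a b w x X₁)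
    (h₂ : SolvesNextStage (gradTaylor U α) γ a b w x X₁ X₂) {t : ℝ} (ht : t ∈ Set.Icc a b) :
    block 0 (X₂ t) = thetaTilde U α γ x (t - a) := by
  have hd (s : ℝ) (_ : s ∈ Set.uIcc a t) := (hasDerivAt_thetaTilde U α γ x (s - a)).comp_sub_const s a
  rw [h₂.theta t ht, intervalIntegral.integral_congr (g := fun s => velocityTilde U α γ x (s - a)),
    intervalIntegral.integral_eq_sub_of_hasDerivAt hd]
  · simp [thetaTilde]
  · exact Continuous.intervalIntegrable (by fun_prop) _ _
  · intro s hs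
    rw [Set.uIcc_of_le ht.1] at hs
    exact second_stage_v₁ h₁ h₂ ⟨hs.1, hs.2.trans ht.2⟩

/-- The end point of a step, tested against a solution of the adjoint equation. -/
lemma step_identity {U : Vec d → ℝ} {α : ℕ} {γ a η : ℝ} (hη : 0 ≤ η)
    {w : ℝ → Vec d} (hw : ContinuousOn w (Set.Icc a (a + η))) {x : Phase d}
    {X₁ X₂ X₃ : ℝ → Phase d} (h₁ : SolvesFirstStage γ a (a + η) w x X₁)
    (h₂ : SolvesNextStage (gradTaylor U α) γ a (a + η) w x X₁ X₂)
    (h₃ : SolvesNextStage (gradTaylor U α) γ a (a + η) w x X₂ X₃) (p : AdjointSolution γ) :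
    p.b₀ 0 • block 0 (X₃ (a + η)) + p.b₁ 0 • block 1 (X₃ (a + η))
        + p.b₂ 0 • block 2 (X₃ (a + η)) + p.b₃ 0 • block 3 (X₃ (a + η))
      = p.b₀ η • block 0 x + (p.b₁ η + p.t₁ η - p.c η) • block 1 x
        + (p.b₂ η + p.t₂ η + p.h₂ η) • block 2 x + (p.kernel η + p.c η) • block 3 x
        - (∫ r in (0 : ℝ)..η, p.b₁ (η - r) • gBar U α γ x r)
        - (∫ r in (0 : ℝ)..η, p.t₁ (η - r) • gTilde U α x r)
        + √(2 * γ) • (p.kernel 0 • (w (a + η) - w a)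
          + ∫ r in (0 : ℝ)..η, p.kernel' (η - r) • (w (a + r) - w a)) := by
  have hab : a ≤ a + η := by linarith
  have key := adjoint_identity hab (continuous_gradTaylor U α) hw h₁ h₂ h₃ p
  have shift (F : ℝ → Vec d) : ∫ t in a..(a + η), F t = ∫ r in (0 : ℝ)..η, F (a + r) := by
    rw [intervalIntegral.integral_comp_add_left]; simp
  rw [shift, shift, shift] at key
  simp only [add_sub_cancel_left, add_sub_add_left_eq_sub] at key
  have mem {r : ℝ} (hr : r ∈ Set.uIcc 0 η) : a + r ∈ Set.Icc a (a + η) := by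
    rw [Set.uIcc_of_le hη] at hr
    exact ⟨by linarith [hr.1], by linarith [hr.2]⟩
  have e1 : ∫ r in (0 : ℝ)..η, p.b₁ (η - r) • gradTaylor U α (block 0 (X₂ (a + r)))
      = ∫ r in (0 : ℝ)..η, p.b₁ (η - r) • gBar U α γ x r :=
    intervalIntegral.integral_congr fun r hr => by
      simp only [second_stage_theta h₁ h₂ (mem hr), add_sub_cancel_left, gBar]
  have e2 : ∫ r in (0 : ℝ)..η, p.t₁ (η - r) • gradTaylor U α (block 0 (X₁ (a + r)))
      = ∫ r in (0 : ℝ)..η, p.t₁ (η - r) • gTilde U α x r :=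
    intervalIntegral.integral_congr fun r hr => by
      simp only [first_stage_theta h₁ (mem hr), add_sub_cancel_left, gTilde]
  rw [key, e1, e2]

/-! ### Explicit adjoint solutions -/

/-- The function `∑ᵢ (aᵢ + bᵢ e⁻ˢ + cᵢ e⁻²ˢ) sⁱ`. -/
noncomputable def expPoly (a b c : Fin 6 → ℝ) (s : ℝ) : ℝ :=
  ∑ i : Fin 6, (a i + b i * Real.exp (-s) + c i * Real.exp (-s) ^ 2) * s ^ (i : ℕ)

/-- The derivative of `expPoly a b c`. -/
noncomputable def expPolyDeriv (a b c : Fin 6 → ℝ) (s : ℝ) : ℝ :=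
  ∑ i : Fin 6, ((-b i * Real.exp (-s) - 2 * c i * Real.exp (-s) ^ 2) * s ^ (i : ℕ)
    + (a i + b i * Real.exp (-s) + c i * Real.exp (-s) ^ 2) * ((i : ℕ) * s ^ ((i : ℕ) - 1)))

/-- Reduces each differential equation below to a comparison of coefficients. The adjoint weights
have no `e⁻²ˢ` part; that part serves the covariances, where two kernels are multiplied. -/
lemma hasDerivAt_expPoly (a b c : Fin 6 → ℝ) (γ u : ℝ) :
    HasDerivAt (fun u => expPoly a b c (γ * u)) (γ * expPolyDeriv a b c (γ * u)) u := by
  have he (s : ℝ) : HasDerivAt (fun s => Real.exp (-s)) (-Real.exp (-s)) s := by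
    simpa using (hasDerivAt_neg s).exp
  have h (s : ℝ) : HasDerivAt (expPoly a b c) (expPolyDeriv a b c s) s := by
    unfold expPoly expPolyDeriv
    refine HasDerivAt.fun_sum fun i _ => ?_
    refine (((((he s).const_mul (b i)).const_add (a i)).add
      (((he s).pow 2).const_mul (c i))).mul (hasDerivAt_pow (i : ℕ) s)).congr_deriv ?_
    simp only [Pi.add_apply, Pi.pow_apply]
    push_cast
    ring
  refine ((h (γ * u)).comp u ((hasDerivAt_id u).const_mul γ)).congr_deriv ?_
  ring

set_option linter.unusedSimpArgs false

/-- The adjoint solution that reads off the position `θ` at the end of the step. -/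
noncomputable def adjointTheta {γ : ℝ} (hγ : γ ≠ 0) : AdjointSolution γ where
  -- The adjoint system is triangular and is solved by successive integration: `b₃`, `b₂`, `b₁`,
  -- then `t₃`, `t₂`, `t₁`, then `h₃`, `h₂`, `c`. Here `b₁ u = u`, which is the source of the factor
  -- `1/γ` in terms of `γ u`.
  b₀ := fun _ => 1
  b₁ := fun u => expPoly ![0, 1, 0, 0, 0, 0] 0 0 (γ * u) / γ
  b₂ := fun _ => 0
  b₃ := fun _ => 0
  t₁ := fun u => expPoly ![0, 0, 0, -1 / 6, 0, 0] 0 0 (γ * u) / γ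
  t₂ := fun u => expPoly ![0, 0, 1 / 2, 0, 0, 0] 0 0 (γ * u) / γ
  t₃ := fun _ => 0
  h₂ := fun u => expPoly ![1, -1, 1 / 2, -1 / 6, -1 / 24, 0] ![-1, 0, 0, 0, 0, 0] 0 (γ * u) / γ
  h₃ := fun u => expPoly ![1, -1, 1 / 2, 0, 0, 0] ![-1, 0, 0, 0, 0, 0] 0 (γ * u) / γ
  c := fun u => expPoly ![-1, 1, -1 / 2, 1 / 6, -1 / 24, -1 / 120] ![1, 0, 0, 0, 0, 0] 0 (γ * u) / γ
  deriv_b₀ u := hasDerivAt_const u _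
  deriv_b₁ u := ((hasDerivAt_expPoly _ _ _ γ u).div_const γ).congr_deriv (by
    simp [expPolyDeriv, expPoly, Fin.sum_univ_six, hγ])
  deriv_b₂ u := (hasDerivAt_const u _).congr_deriv (by simp)
  deriv_b₃ u := (hasDerivAt_const u _).congr_deriv (by simp)
  deriv_t₁ u := ((hasDerivAt_expPoly _ _ _ γ u).div_const γ).congr_deriv (by
    simp [expPolyDeriv, expPoly, Fin.sum_univ_six]; field_simp; ring)
  deriv_t₂ u := ((hasDerivAt_expPoly _ _ _ γ u).div_const γ).congr_deriv (by
    simp [expPolyDeriv, expPoly, Fin.sum_univ_six, hγ])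
  deriv_t₃ u := (hasDerivAt_const u _).congr_deriv (by simp)
  deriv_h₂ u := ((hasDerivAt_expPoly _ _ _ γ u).div_const γ).congr_deriv (by
    simp [expPolyDeriv, expPoly, Fin.sum_univ_six]; field_simp; ring)
  deriv_h₃ u := ((hasDerivAt_expPoly _ _ _ γ u).div_const γ).congr_deriv (by
    simp [expPolyDeriv, expPoly, Fin.sum_univ_six]; field_simp; ring)
  deriv_c u := ((hasDerivAt_expPoly _ _ _ γ u).div_const γ).congr_deriv (by
    simp [expPolyDeriv, expPoly, Fin.sum_univ_six]; field_simp; ring)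
  t₁_zero := by simp [expPoly, Fin.sum_univ_six]
  t₂_zero := by simp [expPoly, Fin.sum_univ_six]
  t₃_zero := by simp [expPoly, Fin.sum_univ_six]
  h₂_zero := by simp [expPoly, Fin.sum_univ_six]
  h₃_zero := by simp [expPoly, Fin.sum_univ_six]
  c_zero := by simp [expPoly, Fin.sum_univ_six]

/-- The adjoint solution that reads off the velocity `v₁` at the end of the step. -/
noncomputable def adjointV₁ (γ : ℝ) : AdjointSolution γ where
  b₀ := fun _ => 0
  b₁ := fun u => expPoly ![1, 0, 0, 0, 0, 0] 0 0 (γ * u)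
  b₂ := fun _ => 0
  b₃ := fun _ => 0
  t₁ := fun u => expPoly ![0, 0, -1 / 2, 0, 0, 0] 0 0 (γ * u)
  t₂ := fun u => expPoly ![0, 1, 0, 0, 0, 0] 0 0 (γ * u)
  t₃ := fun _ => 0
  h₂ := fun u => expPoly ![-1, 1, -1 / 2, -1 / 6, 0, 0] ![1, 0, 0, 0, 0, 0] 0 (γ * u)
  h₃ := fun u => expPoly ![-1, 1, 0, 0, 0, 0] ![1, 0, 0, 0, 0, 0] 0 (γ * u)
  c := fun u => expPoly ![1, -1, 1 / 2, -1 / 6, -1 / 24, 0] ![-1, 0, 0, 0, 0, 0] 0 (γ * u)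
  deriv_b₀ u := hasDerivAt_const u _
  deriv_b₁ u := (hasDerivAt_expPoly _ _ _ γ u).congr_deriv (by
    simp [expPolyDeriv, expPoly, Fin.sum_univ_six])
  deriv_b₂ u := (hasDerivAt_const u _).congr_deriv (by simp)
  deriv_b₃ u := (hasDerivAt_const u _).congr_deriv (by simp)
  deriv_t₁ u := (hasDerivAt_expPoly _ _ _ γ u).congr_deriv (by
    simp [expPolyDeriv, expPoly, Fin.sum_univ_six, -mul_eq_mul_left_iff]; ring)
  deriv_t₂ u := (hasDerivAt_expPoly _ _ _ γ u).congr_deriv (by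
    simp [expPolyDeriv, expPoly, Fin.sum_univ_six])
  deriv_t₃ u := (hasDerivAt_const u _).congr_deriv (by simp)
  deriv_h₂ u := (hasDerivAt_expPoly _ _ _ γ u).congr_deriv (by
    simp [expPolyDeriv, expPoly, Fin.sum_univ_six, -mul_eq_mul_left_iff]; ring)
  deriv_h₃ u := (hasDerivAt_expPoly _ _ _ γ u).congr_deriv (by
    simp [expPolyDeriv, expPoly, Fin.sum_univ_six, -mul_eq_mul_left_iff]; ring)
  deriv_c u := (hasDerivAt_expPoly _ _ _ γ u).congr_deriv (by
    simp [expPolyDeriv, expPoly, Fin.sum_univ_six, -mul_eq_mul_left_iff]; ring)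
  t₁_zero := by simp [expPoly, Fin.sum_univ_six]
  t₂_zero := by simp [expPoly, Fin.sum_univ_six]
  t₃_zero := by simp [expPoly, Fin.sum_univ_six]
  h₂_zero := by simp [expPoly, Fin.sum_univ_six]
  h₃_zero := by simp [expPoly, Fin.sum_univ_six]
  c_zero := by simp [expPoly, Fin.sum_univ_six]

/-- The adjoint solution that reads off the variable `v₂` at the end of the step. -/
noncomputable def adjointV₂ (γ : ℝ) : AdjointSolution γ where
  b₀ := fun _ => 0
  b₁ := fun u => expPoly ![0, -1, 0, 0, 0, 0] 0 0 (γ * u)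
  b₂ := fun u => expPoly ![1, 0, 0, 0, 0, 0] 0 0 (γ * u)
  b₃ := fun _ => 0
  t₁ := fun u => expPoly ![1, -1, 1 / 2, 1 / 6, 0, 0] ![-1, 0, 0, 0, 0, 0] 0 (γ * u)
  t₂ := fun u => expPoly ![1, -1, -1 / 2, 0, 0, 0] ![-1, 0, 0, 0, 0, 0] 0 (γ * u)
  t₃ := fun u => expPoly ![1, 0, 0, 0, 0, 0] ![-1, 0, 0, 0, 0, 0] 0 (γ * u)
  h₂ := fun u => expPoly ![1, 0, -1 / 2, 1 / 3, 1 / 24, 0] ![-1, -1, 0, 0, 0, 0] 0 (γ * u)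
  h₃ := fun u => expPoly ![1, 0, -1 / 2, 0, 0, 0] ![-1, -1, 0, 0, 0, 0] 0 (γ * u)
  c := fun u => expPoly ![-2, 1, 0, -1 / 6, 1 / 12, 1 / 120] ![2, 1, 0, 0, 0, 0] 0 (γ * u)
  deriv_b₀ u := hasDerivAt_const u _
  deriv_b₁ u := (hasDerivAt_expPoly _ _ _ γ u).congr_deriv (by
    simp [expPolyDeriv, expPoly, Fin.sum_univ_six])
  deriv_b₂ u := (hasDerivAt_expPoly _ _ _ γ u).congr_deriv (by
    simp [expPolyDeriv, expPoly, Fin.sum_univ_six])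
  deriv_b₃ u := (hasDerivAt_const u _).congr_deriv (by simp)
  deriv_t₁ u := (hasDerivAt_expPoly _ _ _ γ u).congr_deriv (by
    simp [expPolyDeriv, expPoly, Fin.sum_univ_six, -mul_eq_mul_left_iff]; ring)
  deriv_t₂ u := (hasDerivAt_expPoly _ _ _ γ u).congr_deriv (by
    simp [expPolyDeriv, expPoly, Fin.sum_univ_six, -mul_eq_mul_left_iff]; ring)
  deriv_t₃ u := (hasDerivAt_expPoly _ _ _ γ u).congr_deriv (by
    simp [expPolyDeriv, expPoly, Fin.sum_univ_six, -mul_eq_mul_left_iff]; ring)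
  deriv_h₂ u := (hasDerivAt_expPoly _ _ _ γ u).congr_deriv (by
    simp [expPolyDeriv, expPoly, Fin.sum_univ_six, -mul_eq_mul_left_iff]; ring)
  deriv_h₃ u := (hasDerivAt_expPoly _ _ _ γ u).congr_deriv (by
    simp [expPolyDeriv, expPoly, Fin.sum_univ_six, -mul_eq_mul_left_iff]; ring)
  deriv_c u := (hasDerivAt_expPoly _ _ _ γ u).congr_deriv (by
    simp [expPolyDeriv, expPoly, Fin.sum_univ_six, -mul_eq_mul_left_iff]; ring)
  t₁_zero := by simp [expPoly, Fin.sum_univ_six]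
  t₂_zero := by simp [expPoly, Fin.sum_univ_six]
  t₃_zero := by simp [expPoly, Fin.sum_univ_six]
  h₂_zero := by simp [expPoly, Fin.sum_univ_six]
  h₃_zero := by simp [expPoly, Fin.sum_univ_six]
  c_zero := by simp [expPoly, Fin.sum_univ_six]

/-- The adjoint solution that reads off the variable `v₃` at the end of the step. -/
noncomputable def adjointV₃ (γ : ℝ) : AdjointSolution γ where
  b₀ := fun _ => 0
  b₁ := fun u => expPoly ![-1, 1, 0, 0, 0, 0] ![1, 0, 0, 0, 0, 0] 0 (γ * u)
  b₂ := fun u => expPoly ![-1, 0, 0, 0, 0, 0] ![1, 0, 0, 0, 0, 0] 0 (γ * u)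
  b₃ := fun u => expPoly 0 ![1, 0, 0, 0, 0, 0] 0 (γ * u)
  t₁ := fun u => expPoly ![-2, 1, 0, -1 / 6, 0, 0] ![2, 1, 0, 0, 0, 0] 0 (γ * u)
  t₂ := fun u => expPoly ![-1, 0, 1 / 2, 0, 0, 0] ![1, 1, 0, 0, 0, 0] 0 (γ * u)
  t₃ := fun u => expPoly ![-1, 0, 0, 0, 0, 0] ![1, 1, 0, 0, 0, 0] 0 (γ * u)
  h₂ := fun u => expPoly ![1, -2, 1, -1 / 6, -1 / 24, 0] ![-1, 1, 1 / 2, 0, 0, 0] 0 (γ * u)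
  h₃ := fun u => expPoly ![0, -1, 1 / 2, 0, 0, 0] ![0, 1, 1 / 2, 0, 0, 0] 0 (γ * u)
  c := fun u => expPoly ![1, 1, -1, 1 / 3, -1 / 24, -1 / 120] ![-1, -2, -1 / 2, 0, 0, 0] 0 (γ * u)
  deriv_b₀ u := hasDerivAt_const u _
  deriv_b₁ u := (hasDerivAt_expPoly _ _ _ γ u).congr_deriv (by
    simp [expPolyDeriv, expPoly, Fin.sum_univ_six, -mul_eq_mul_left_iff]; ring)
  deriv_b₂ u := (hasDerivAt_expPoly _ _ _ γ u).congr_deriv (by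
    simp [expPolyDeriv, expPoly, Fin.sum_univ_six])
  deriv_b₃ u := (hasDerivAt_expPoly _ _ _ γ u).congr_deriv (by
    simp [expPolyDeriv, expPoly, Fin.sum_univ_six])
  deriv_t₁ u := (hasDerivAt_expPoly _ _ _ γ u).congr_deriv (by
    simp [expPolyDeriv, expPoly, Fin.sum_univ_six, -mul_eq_mul_left_iff]; ring)
  deriv_t₂ u := (hasDerivAt_expPoly _ _ _ γ u).congr_deriv (by
    simp [expPolyDeriv, expPoly, Fin.sum_univ_six, -mul_eq_mul_left_iff]; ring)
  deriv_t₃ u := (hasDerivAt_expPoly _ _ _ γ u).congr_deriv (by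
    simp [expPolyDeriv, expPoly, Fin.sum_univ_six, -mul_eq_mul_left_iff]; ring)
  deriv_h₂ u := (hasDerivAt_expPoly _ _ _ γ u).congr_deriv (by
    simp [expPolyDeriv, expPoly, Fin.sum_univ_six, -mul_eq_mul_left_iff]; ring)
  deriv_h₃ u := (hasDerivAt_expPoly _ _ _ γ u).congr_deriv (by
    simp [expPolyDeriv, expPoly, Fin.sum_univ_six, -mul_eq_mul_left_iff]; ring)
  deriv_c u := (hasDerivAt_expPoly _ _ _ γ u).congr_deriv (by
    simp [expPolyDeriv, expPoly, Fin.sum_univ_six, -mul_eq_mul_left_iff]; ring)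
  t₁_zero := by simp [expPoly, Fin.sum_univ_six]
  t₂_zero := by simp [expPoly, Fin.sum_univ_six]
  t₃_zero := by simp [expPoly, Fin.sum_univ_six]
  h₂_zero := by simp [expPoly, Fin.sum_univ_six]
  h₃_zero := by simp [expPoly, Fin.sum_univ_six]
  c_zero := by simp [expPoly, Fin.sum_univ_six]


/-- The adjoint solutions for the four blocks. -/
noncomputable def adjoint {γ : ℝ} (hγ : γ ≠ 0) : Fin 4 → AdjointSolution γ :=
  ![adjointTheta hγ, adjointV₁ γ, adjointV₂ γ, adjointV₃ γ]

/-! ### Matching the adjoint weights with the coefficients of the mean -/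

section Coefficients

variable {γ : ℝ} (hγ : γ ≠ 0) (η : ℝ)

lemma muCoeff_zero (i : Fin 4) : (adjoint hγ i).b₀ η = muCoeff γ η i 0 := by
  fin_cases i <;> simp [adjoint, adjointTheta, adjointV₁, adjointV₂, adjointV₃, muCoeff]

lemma muCoeff_one (i : Fin 4) :
    (adjoint hγ i).b₁ η + (adjoint hγ i).t₁ η - (adjoint hγ i).c η = muCoeff γ η i 1 := by
  fin_cases i <;> simp [adjoint, adjointTheta, adjointV₁, adjointV₂, adjointV₃, muCoeff, expPoly,
    Fin.sum_univ_six] <;> ring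

lemma muCoeff_two (i : Fin 4) :
    (adjoint hγ i).b₂ η + (adjoint hγ i).t₂ η + (adjoint hγ i).h₂ η = muCoeff γ η i 2 := by
  fin_cases i <;> simp [adjoint, adjointTheta, adjointV₁, adjointV₂, adjointV₃, muCoeff, expPoly,
    Fin.sum_univ_six] <;> ring

lemma muCoeff_three (i : Fin 4) :
    (adjoint hγ i).kernel η + (adjoint hγ i).c η = muCoeff γ η i 3 := by
  fin_cases i <;> simp [adjoint, adjointTheta, adjointV₁, adjointV₂, adjointV₃, muCoeff, expPoly,
    AdjointSolution.kernel, Fin.sum_univ_six] <;> ring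


lemma integral_smul_congr {E : Type*} [NormedAddCommGroup E] [NormedSpace ℝ E] {f g : ℝ → ℝ}
    {F : ℝ → E} {a b : ℝ} (h : ∀ r, f r = g r) :
    ∫ r in a..b, f r • F r = ∫ r in a..b, g r • F r := by
  simp only [h]

lemma integral_smul_congr_neg {E : Type*} [NormedAddCommGroup E] [NormedSpace ℝ E] {f g : ℝ → ℝ}
    {F : ℝ → E} {a b : ℝ} (h : ∀ r, f r = -g r) :
    ∫ r in a..b, f r • F r = -∫ r in a..b, g r • F r := by
  simp only [h, neg_smul, intervalIntegral.integral_neg]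

lemma gradPart_eq {d : ℕ} (U : Vec d → ℝ) (α : ℕ) (x : Phase d) (i : Fin 4) :
    -(∫ r in (0 : ℝ)..η, (adjoint hγ i).b₁ (η - r) • gBar U α γ x r)
      - (∫ r in (0 : ℝ)..η, (adjoint hγ i).t₁ (η - r) • gTilde U α x r)
      = gradPart U α γ η x i := by
  fin_cases i
  · rw [integral_smul_congr (F := gBar U α γ x) (g := fun r => η - r),
      integral_smul_congr_neg (F := gTilde U α x) (g := fun r => γ ^ 2 * (η - r) ^ 3 / 6)]
    · simp [gradPart]
    all_goals
      intro r
      simp [adjoint, adjointTheta, expPoly, Fin.sum_univ_six]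
      field_simp
  · rw [integral_smul_congr (F := gBar U α γ x) (g := fun r => 1),
      integral_smul_congr_neg (F := gTilde U α x) (g := fun r => γ ^ 2 * (η - r) ^ 2 / 2)]
    · simp [gradPart]
    · intro r
      simp [adjoint, adjointV₁, expPoly, Fin.sum_univ_six]
      ring
    · intro r
      simp [adjoint, adjointV₁, expPoly, Fin.sum_univ_six]
  · rw [integral_smul_congr_neg (F := gBar U α γ x) (g := fun r => γ * (η - r)),
      integral_smul_congr (F := gTilde U α x) (g := fun r => (γ * (η - r)) ^ 3 / 6 + (γ * (η - r)) ^ 2 / 2 - γ * (η - r) + 1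
        - Real.exp (-(γ * (η - r))))]
    · simp [gradPart]
    · intro r
      simp [adjoint, adjointV₂, expPoly, Fin.sum_univ_six]
      ring
    · intro r
      simp [adjoint, adjointV₂, expPoly, Fin.sum_univ_six]
  · rw [integral_smul_congr (F := gBar U α γ x) (g := fun r => γ * (η - r) - 1 + Real.exp (-(γ * (η - r)))),
      integral_smul_congr_neg (F := gTilde U α x) (g := fun r => (γ * (η - r)) ^ 3 / 6 - γ * (η - r) + 2
          - (2 + γ * (η - r)) * Real.exp (-(γ * (η - r))))]
    · simp [gradPart]
    all_goals
      intro r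
      simp [adjoint, adjointV₃, expPoly, Fin.sum_univ_six]
      ring

/-- The third-stage weights of the `i`-th adjoint solution start at the `i`-th unit vector; this
normalisation makes the pairing isolate one block of the end point. -/
lemma adjoint_zero {d : ℕ} (y : Fin 4 → Vec d) (i : Fin 4) :
    (adjoint hγ i).b₀ 0 • y 0 + (adjoint hγ i).b₁ 0 • y 1 + (adjoint hγ i).b₂ 0 • y 2
      + (adjoint hγ i).b₃ 0 • y 3 = y i := by
  fin_cases i <;> simp [adjoint, adjointTheta, adjointV₁, adjointV₂, adjointV₃, expPoly,
    Fin.sum_univ_six]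

end Coefficients

/-! ### The covariance matrix -/

lemma kernel_eq {γ : ℝ} (hγ : γ ≠ 0) (u : ℝ) (i : Fin 4) :
    (adjoint hγ i).kernel u =
      (![(1 - γ * u + (γ * u) ^ 2 / 2 - Real.exp (-(γ * u))) / γ,
        -1 + γ * u + Real.exp (-(γ * u)),
        2 - (γ * u) ^ 2 / 2 - (2 + γ * u) * Real.exp (-(γ * u)),
        -1 - γ * u + (γ * u) ^ 2 / 2 + (2 + 2 * (γ * u) + (γ * u) ^ 2 / 2) * Real.exp (-(γ * u))]
        : Fin 4 → ℝ) i := by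
  fin_cases i <;> simp [adjoint, adjointTheta, adjointV₁, adjointV₂, adjointV₃, expPoly,
    AdjointSolution.kernel, Fin.sum_univ_six] <;> ring

/-- The kernels are combinations of `1` and `e⁻ˢ` with polynomial coefficients of degree at most
two. An antiderivative of a product therefore has powers of `s` up to five and of `e⁻ˢ` up to two,
which is the range of `expPoly`. -/
lemma hasDerivAt_sigmaUpper {γ : ℝ} (hγ : γ ≠ 0) (u : ℝ) {i j : Fin 4} (hij : i ≤ j) :
    HasDerivAt (fun u => sigmaUpper γ u i j)
      (2 * γ * ((adjoint hγ i).kernel u * (adjoint hγ j).kernel u)) u := by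
  have key {F : ℝ → ℝ} {F' : ℝ} (a b c : Fin 6 → ℝ) (hF : ∀ u, F u = expPoly a b c (γ * u))
      (hF' : F' = γ * expPolyDeriv a b c (γ * u)) : HasDerivAt F F' u := by
    rw [funext hF, hF']
    exact hasDerivAt_expPoly a b c γ u
  rw [kernel_eq, kernel_eq]
  fin_cases i <;> fin_cases j <;> first | exact absurd hij (by decide) | skip
  -- In each case the three vectors are the coefficients of `1`, `e` and `e²` in the corresponding
  -- entry of `sigmaUpper`.
  · refine key (γ⁻¹ ^ 2 • ![-3, 2, -2, 4 / 3, -1 / 2, 1 / 10])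
      (γ⁻¹ ^ 2 • ![4, 0, 2, 0, 0, 0])
      (γ⁻¹ ^ 2 • ![-1, 0, 0, 0, 0, 0]) (fun u => ?_) ?_
    · simp [sigmaUpper, expPoly, Fin.sum_univ_six]; field_simp; ring
    · simp [expPolyDeriv, Fin.sum_univ_six]; field_simp; ring
  · refine key (γ⁻¹ • ![1, -2, 2, -1, 1 / 4, 0])
      (γ⁻¹ • ![-2, 2, -1, 0, 0, 0])
      (γ⁻¹ • ![1, 0, 0, 0, 0, 0]) (fun u => ?_) ?_
    · simp [sigmaUpper, expPoly, Fin.sum_univ_six]; field_simp; ring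
    · simp [expPolyDeriv, Fin.sum_univ_six]; field_simp; ring
  · refine key (γ⁻¹ • ![-15 / 2, 4, -2, 1 / 3, 1 / 4, -1 / 10])
      (γ⁻¹ • ![10, 2, 2, 1, 0, 0])
      (γ⁻¹ • ![-5 / 2, -1, 0, 0, 0, 0]) (fun u => ?_) ?_
    · simp [sigmaUpper, expPoly, Fin.sum_univ_six]; field_simp; ring
    · simp [expPolyDeriv, Fin.sum_univ_six]; field_simp; ring
  · refine key (γ⁻¹ • ![75 / 4, -2, 0, 2 / 3, -1 / 2, 1 / 10])
      (γ⁻¹ • ![-22, -16, -7, -3, -1 / 2, 0])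
      (γ⁻¹ • ![13 / 4, 5 / 2, 1 / 2, 0, 0, 0]) (fun u => ?_) ?_
    · simp [sigmaUpper, expPoly, Fin.sum_univ_six]; field_simp; ring
    · simp [expPolyDeriv, Fin.sum_univ_six]; field_simp; ring
  · refine key ![1, 2, -2, 2 / 3, 0, 0]
      ![0, -4, 0, 0, 0, 0]
      ![-1, 0, 0, 0, 0, 0] (fun u => ?_) ?_
    · simp [sigmaUpper, expPoly, Fin.sum_univ_six]; field_simp; ring
    · simp [expPolyDeriv, Fin.sum_univ_six]; field_simp; ring
  · refine key ![-5 / 2, -4, 2, 1 / 3, -1 / 4, 0]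
      ![0, 8, 3, 0, 0, 0]
      ![5 / 2, 1, 0, 0, 0, 0] (fun u => ?_) ?_
    · simp [sigmaUpper, expPoly, Fin.sum_univ_six]; field_simp; ring
    · simp [expPolyDeriv, Fin.sum_univ_six]; field_simp; ring
  · refine key ![37 / 4, 2, 0, -1, 1 / 4, 0]
      ![-6, -12, -7, -1, 0, 0]
      ![-13 / 4, -5 / 2, -1 / 2, 0, 0, 0] (fun u => ?_) ?_
    · simp [sigmaUpper, expPoly, Fin.sum_univ_six]; field_simp; ring
    · simp [expPolyDeriv, Fin.sum_univ_six]; field_simp; ring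
  · refine key ![5 / 2, 8, 0, -4 / 3, 0, 1 / 10]
      ![4, -12, -10, -2, 0, 0]
      ![-13 / 2, -5, -1, 0, 0, 0] (fun u => ?_) ?_
    · simp [sigmaUpper, expPoly, Fin.sum_univ_six]; field_simp; ring
    · simp [expPolyDeriv, Fin.sum_univ_six]; field_simp; ring
  · refine key ![-103 / 8, -4, -2, 1, 1 / 4, -1 / 10]
      ![4, 16, 15, 5, 1 / 2, 0]
      ![71 / 8, 39 / 4, 15 / 4, 1 / 2, 0, 0] (fun u => ?_) ?_
    · simp [sigmaUpper, expPoly, Fin.sum_univ_six]; field_simp; ring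
    · simp [expPolyDeriv, Fin.sum_univ_six]; field_simp; ring
  · refine key ![103 / 8, 2, 2, 0, -1 / 2, 1 / 10]
      ![0, -8, -12, -6, -1, 0]
      ![-103 / 8, -71 / 4, -39 / 4, -5 / 2, -1 / 4, 0] (fun u => ?_) ?_
    · simp [sigmaUpper, expPoly, Fin.sum_univ_six]; field_simp; ring
    · simp [expPolyDeriv, Fin.sum_univ_six]; field_simp; ring

lemma sigmaUpper_zero (γ : ℝ) (i j : Fin 4) : sigmaUpper γ 0 i j = 0 := by
  fin_cases i <;> fin_cases j <;> simp [sigmaUpper] <;> norm_num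

lemma sigmaUpper_eq_integral {γ : ℝ} (hγ : γ ≠ 0) (η : ℝ) {i j : Fin 4} (hij : i ≤ j) :
    sigmaUpper γ η i j
      = 2 * γ * ∫ u in (0 : ℝ)..η, (adjoint hγ i).kernel u * (adjoint hγ j).kernel u := by
  rw [← intervalIntegral.integral_const_mul,
    intervalIntegral.integral_eq_sub_of_hasDerivAt (fun u _ => hasDerivAt_sigmaUpper hγ u hij),
    sigmaUpper_zero, sub_zero]
  exact (continuous_const.mul ((adjoint hγ i).continuous_kernel.mul
    (adjoint hγ j).continuous_kernel)).intervalIntegrable _ _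

lemma sigmaCoeff_eq_integral {γ : ℝ} (hγ : γ ≠ 0) (η : ℝ) (i j : Fin 4) :
    sigmaCoeff γ η i j
      = 2 * γ * ∫ u in (0 : ℝ)..η, (adjoint hγ i).kernel u * (adjoint hγ j).kernel u := by
  rcases le_total i j with h | h
  · simpa [sigmaCoeff, h] using sigmaUpper_eq_integral hγ η h
  · simpa [sigmaCoeff, h, mul_comm] using sigmaUpper_eq_integral hγ η h

/-- The quadratic form of `(σ_{ij})` is the squared norm of a combination of the kernels. -/
lemma sum_sigmaCoeff_mul {γ : ℝ} (hγ : γ ≠ 0) (η : ℝ) (z : Fin 4 → ℝ) :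
    ∑ i, ∑ j, z i * sigmaCoeff γ η i j * z j
      = 2 * γ * ∫ u in (0 : ℝ)..η, (∑ i, z i * (adjoint hγ i).kernel u) ^ 2 := by
  have hc (i) := (adjoint hγ i).continuous_kernel
  simp_rw [sigmaCoeff_eq_integral hγ, pow_two, Finset.sum_mul_sum]
  rw [intervalIntegral.integral_finsetSum fun i _ =>
    Continuous.intervalIntegrable (by fun_prop) _ _, Finset.mul_sum]
  refine Finset.sum_congr rfl fun i _ => ?_
  rw [intervalIntegral.integral_finsetSum fun i _ =>
    Continuous.intervalIntegrable (by fun_prop) _ _, Finset.mul_sum]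
  refine Finset.sum_congr rfl fun j _ => ?_
  have : ∀ u, z i * (adjoint hγ i).kernel u * (z j * (adjoint hγ j).kernel u)
      = z i * z j * ((adjoint hγ i).kernel u * (adjoint hγ j).kernel u) := fun u => by ring
  simp_rw [this, intervalIntegral.integral_const_mul]
  ring

/-- The matrix `(σ_{ij})` is `2γ` times the Gram matrix of the kernels in `L²(0, η)`, and the
Kronecker product with the identity preserves positivity. -/
lemma covMat_posSemidef (d : ℕ) {γ η : ℝ} (hγ : 0 < γ) (hη : 0 ≤ η) :
    (covMat d γ η).PosSemidef := by
  refine Matrix.PosSemidef.kronecker ?_ Matrix.PosSemidef.one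
  refine Matrix.PosSemidef.of_dotProduct_mulVec_nonneg ?_ fun z => ?_
  · ext i j
    simp [sigmaCoeff_eq_integral hγ.ne', mul_comm]
  · have := sum_sigmaCoeff_mul hγ.ne' η z
    have h0 : 0 ≤ 2 * γ * ∫ u in (0 : ℝ)..η, (∑ i, z i * (adjoint hγ.ne' i).kernel u) ^ 2 :=
      mul_nonneg (by positivity) (intervalIntegral.integral_nonneg hη fun u _ => sq_nonneg _)
    rw [← this] at h0
    simpa [dotProduct, Matrix.mulVec, Finset.mul_sum, mul_assoc] using h0

/-- The quadratic form of the covariance matrix. -/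
lemma dotProduct_covMat_mulVec {d : ℕ} {γ : ℝ} (hγ : γ ≠ 0) (η : ℝ) (ξ : Fin 4 × Fin d → ℝ) :
    ξ ⬝ᵥ (covMat d γ η).mulVec ξ
      = ∑ j, 2 * γ * ∫ u in (0 : ℝ)..η, (∑ i, ξ (i, j) * (adjoint hγ i).kernel u) ^ 2 := by
  simp_rw [← sum_sigmaCoeff_mul hγ η]
  simp only [dotProduct, Matrix.mulVec, covMat, Fintype.sum_prod_type, Matrix.kroneckerMap_apply,
    Matrix.one_apply, mul_ite, mul_one, mul_zero, ite_mul, zero_mul, Finset.sum_ite_eq,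
    Finset.mem_univ, if_true, Finset.mul_sum]
  rw [Finset.sum_comm]
  simp only [mul_assoc]

/-! ### Wiener integrals of smooth kernels -/

/-- The sums that approximate `∫₀^η f (η - r) dw r`. -/
noncomputable def wienerSum (f : ℝ → ℝ) (η : ℝ) (w : ℝ → ℝ) (n : ℕ) : ℝ :=
  ∑ m ∈ Finset.range n,
    f (η - m * (η / n)) * (w ((m + 1 : ℕ) * (η / n)) - w (m * (η / n)))

/-- The integral `∫₀^η f (η - r) dw r` for a path `w` that starts at `0`, after an integration by
parts; `f'` is the derivative of `f`. -/
noncomputable def wienerIntegral (f f' : ℝ → ℝ) (η : ℝ) (w : ℝ → ℝ) : ℝ :=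
  f 0 * w η + ∫ r in (0 : ℝ)..η, f' (η - r) * w r

lemma sum_integral_grid {η : ℝ} {h : ℝ → ℝ} (hh : Continuous h) {n : ℕ} (hn : n ≠ 0) :
    ∑ m ∈ Finset.range n, ∫ r in (m * (η / n) : ℝ)..((m + 1 : ℕ) * (η / n)), h r
      = ∫ r in (0 : ℝ)..η, h r := by
  have hn' : (n : ℝ) ≠ 0 := by exact_mod_cast hn
  have := intervalIntegral.sum_integral_adjacent_intervals (μ := volume) (f := h)
    (a := fun m : ℕ => (m : ℝ) * (η / n)) (n := n) fun k _ => hh.intervalIntegrable _ _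
  rw [this]
  congr 1
  · simp
  · field_simp

/-- Uniform continuity of `g` on `[0, η]` bounds the error by a small multiple of `∫ |h|`. Free
sampling points allow two uses: right end points with `g` the path, and left end points with `g` the
squared kernel and `h = 1`. -/
lemma tendsto_sum_mul_integral {η : ℝ} (hη : 0 < η) {g h : ℝ → ℝ} (hg : Continuous g)
    (hh : Continuous h) (τ : ℕ → ℕ → ℝ)
    (hτ : ∀ n m : ℕ, τ n m ∈ Set.Icc (m * (η / n)) ((m + 1 : ℕ) * (η / n))) :
    Filter.Tendsto (fun n : ℕ => ∑ m ∈ Finset.range n,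
      g (τ n m) * ∫ r in (m * (η / n) : ℝ)..((m + 1 : ℕ) * (η / n)), h r) Filter.atTop
      (nhds (∫ r in (0 : ℝ)..η, g r * h r)) := by
  rw [Metric.tendsto_atTop]
  intro ε hε
  set C := ∫ r in (0 : ℝ)..η, |h r| with hC
  have hC0 : 0 ≤ C := intervalIntegral.integral_nonneg hη.le fun r _ => abs_nonneg _
  have huc := isCompact_Icc (a := (0 : ℝ)) (b := η).uniformContinuousOn_of_continuous
    hg.continuousOn
  -- The denominator is `C + 1` because `C` may vanish.
  obtain ⟨δ, hδ, H⟩ := Metric.uniformContinuousOn_iff.1 huc (ε / (C + 1)) (by positivity)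
  obtain ⟨N, hN⟩ := exists_nat_gt (η / δ)
  refine ⟨max N 1, fun n hn => ?_⟩
  have hn1 : 1 ≤ n := le_trans (le_max_right _ _) hn
  have hn0 : (0 : ℝ) < n := by exact_mod_cast hn1
  have hstep : η / n < δ := by
    rw [div_lt_iff₀ hn0, mul_comm, ← div_lt_iff₀ hδ]
    exact hN.trans_le (by exact_mod_cast le_trans (le_max_left _ _) hn)
  have hs0 : 0 < η / n := by positivity
  have hgrid (m : ℕ) (hm : m < n) : ((m + 1 : ℕ) : ℝ) * (η / n) ≤ η := by
    have : ((m + 1 : ℕ) : ℝ) ≤ n := by exact_mod_cast hm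
    calc ((m + 1 : ℕ) : ℝ) * (η / n) ≤ n * (η / n) := by gcongr
      _ = η := by field_simp
  have hle (m : ℕ) : (m : ℝ) * (η / n) ≤ ((m + 1 : ℕ) : ℝ) * (η / n) := by
    gcongr; simp
  rw [← sum_integral_grid (h := fun r => g r * h r) (hg.mul hh) (Nat.one_le_iff_ne_zero.1 hn1), Real.dist_eq, ← Finset.sum_sub_distrib]
  have hterm : ∀ m ∈ Finset.range n,
      |g (τ n m) * (∫ r in (m * (η / n) : ℝ)..((m + 1 : ℕ) * (η / n)), h r)
        - ∫ r in (m * (η / n) : ℝ)..((m + 1 : ℕ) * (η / n)), g r * h r|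
      ≤ ε / (C + 1) * ∫ r in (m * (η / n) : ℝ)..((m + 1 : ℕ) * (η / n)), |h r| := by
    intro m hm
    rw [Finset.mem_range] at hm
    rw [← intervalIntegral.integral_const_mul, ← intervalIntegral.integral_sub
      (Continuous.intervalIntegrable (by fun_prop) _ _)
      (Continuous.intervalIntegrable (by fun_prop) _ _),
      ← intervalIntegral.integral_const_mul]
    refine (intervalIntegral.abs_integral_le_integral_abs (hle m)).trans ?_
    refine intervalIntegral.integral_mono_on (hle m)
      (Continuous.intervalIntegrable (by fun_prop) _ _)
      (Continuous.intervalIntegrable (by fun_prop) _ _) fun r hr => ?_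
    rw [← sub_mul, abs_mul]
    gcongr
    have h0 : 0 ≤ (m : ℝ) * (η / n) := by positivity
    have h1 := hτ n m
    have h2 := hgrid m hm
    refine (H (τ n m) ⟨h0.trans h1.1, h1.2.trans h2⟩ r ⟨h0.trans hr.1, hr.2.trans h2⟩ ?_).le
    have h3 : ((m + 1 : ℕ) : ℝ) * (η / n) = m * (η / n) + η / n := by push_cast; ring
    rw [Real.dist_eq, abs_lt]
    constructor <;> linarith [h1.1, h1.2, hr.1, hr.2]
  refine (Finset.abs_sum_le_sum_abs _ _).trans_lt ((Finset.sum_le_sum hterm).trans_lt ?_)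
  rw [← Finset.mul_sum, sum_integral_grid hh.abs (Nat.one_le_iff_ne_zero.1 hn1), ← hC, div_mul_eq_mul_div,
    div_lt_iff₀ (by positivity)]
  nlinarith

/-- Summation by parts moves the differences from the path to the smooth kernel, so convergence
holds for every continuous path starting at `0`, with no probability involved. -/
lemma tendsto_wienerSum {η : ℝ} (hη : 0 < η) {f f' : ℝ → ℝ} (hf : ∀ u, HasDerivAt f (f' u) u)
    (hf' : Continuous f') {w : ℝ → ℝ} (hw : Continuous w) (hw0 : w 0 = 0) :
    Filter.Tendsto (wienerSum f η w) Filter.atTop (nhds (wienerIntegral f f' η w)) := by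
  have hrev (t : ℝ) : HasDerivAt (fun t => f (η - t)) (-f' (η - t)) t := by
    have := (hf (η - t)).comp t ((hasDerivAt_id t).const_sub η)
    simpa [Function.comp_def] using this
  have hc : Continuous fun t => f' (η - t) := hf'.comp (continuous_const.sub continuous_id)
  have key := (tendsto_sum_mul_integral hη hw hc (fun n m => (m + 1 : ℕ) * (η / n))
    (fun n m => ⟨by gcongr; simp, le_rfl⟩)).const_add (f 0 * w η)
  have hlim : f 0 * w η + ∫ r in (0 : ℝ)..η, w r * f' (η - r) = wienerIntegral f f' η w := by
    simp only [wienerIntegral, mul_comm (w _)]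
  rw [hlim] at key
  refine key.congr' ?_
  filter_upwards [Filter.eventually_ge_atTop 1] with n hn
  have hn0 : (n : ℝ) ≠ 0 := by positivity
  have hint (m : ℕ) : ∫ r in (m * (η / n) : ℝ)..((m + 1 : ℕ) * (η / n)), f' (η - r)
      = f (η - m * (η / n)) - f (η - (m + 1 : ℕ) * (η / n)) := by
    have := intervalIntegral.integral_eq_sub_of_hasDerivAt
      (a := (m * (η / n) : ℝ)) (b := ((m + 1 : ℕ) * (η / n))) (fun t _ => hrev t)
      (hc.neg.intervalIntegrable _ _)
    rw [intervalIntegral.integral_neg] at this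
    linarith
  -- The telescoping product leaves `f 0 * w η`. The remaining differences of `f` multiply the path
  -- at right end points, which dictates the sampling in `key`.
  have htel := Finset.sum_range_sub (fun m : ℕ => f (η - m * (η / n)) * w (m * (η / n))) n
  have he : (n : ℝ) * (η / n) = η := by field_simp
  simp only [he, sub_self, Nat.cast_zero, zero_mul, hw0, mul_zero, sub_zero] at htel
  rw [← htel, ← Finset.sum_add_distrib]
  refine Finset.sum_congr rfl fun m _ => ?_
  rw [hint]
  ring

variable {Ω : Type*} [MeasurableSpace Ω] {P : Measure Ω}

open Complex in
-- The grid increments are independent centred Gaussians of variance `η / n`, so the characteristic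
-- function factorises.
lemma integral_exp_wienerSum {B : ℝ≥0 → Ω → ℝ} (hB : IsPreBrownianReal B P) {η : ℝ} (hη : 0 < η)
    (f : ℝ → ℝ) (n : ℕ) :
    ∫ ω, cexp (wienerSum f η (fun r => B r.toNNReal ω) n * I) ∂P
      = cexp (-((∑ m ∈ Finset.range n, f (η - m * (η / n)) ^ 2 * (η / n) : ℝ)) / 2) := by
  let t : ℕ → ℝ≥0 := fun m => (m * (η / n)).toNNReal
  have ht : Monotone t := fun a b hab => Real.toNNReal_le_toNNReal (by gcongr)
  have hind := (hB.hasIndepIncrements.nat ht).precomp (Fin.val_injective (n := n))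
  have hmeas (s : ℝ≥0) := hB.aemeasurable s
  have hprod := hind.integral_fun_prod_comp
    (f := fun (m : Fin n) x => cexp ((f (η - m * (η / n)) : ℝ) * (x : ℝ) * I))
    (fun m => (hmeas _).sub (hmeas _)) (fun m => by fun_prop)
  have hfac (m : ℕ) : ∫ ω, cexp ((f (η - m * (η / n)) : ℝ) *
      ((B (t (m + 1)) ω - B (t m) ω : ℝ)) * I) ∂P
      = cexp (-((f (η - m * (η / n)) ^ 2 * (η / n) : ℝ)) / 2) := by
    have h1 := (hB.hasLaw_sub (t (m + 1)) (t m)).integral_comp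
      (f := fun x => cexp ((f (η - m * (η / n)) : ℝ) * (x : ℝ) * I)) (by fun_prop)
    have h2 := charFun_gaussianReal (μ := 0) (v := nndist (t (m + 1)).1 (t m).1)
      (f (η - m * (η / n)))
    rw [charFun_apply_real] at h2
    have h3 : ((nndist (t (m + 1)).1 (t m).1 : ℝ≥0) : ℝ) = η / n := by
      have e1 : (t (m + 1)).1 = (m + 1 : ℕ) * (η / n) := Real.coe_toNNReal _ (by positivity)
      have e2 : (t m).1 = m * (η / n) := Real.coe_toNNReal _ (by positivity)
      rw [coe_nndist, Real.dist_eq, e1, e2, ← sub_mul]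
      simp only [Nat.cast_add, Nat.cast_one, add_sub_cancel_left, one_mul]
      exact abs_of_nonneg (by positivity)
    refine h1.trans (h2.trans ?_)
    rw [h3]
    congr 1
    push_cast
    ring
  simp_rw [hfac] at hprod
  calc ∫ ω, cexp (wienerSum f η (fun r => B r.toNNReal ω) n * I) ∂P
      = ∫ ω, ∏ m : Fin n, cexp ((f (η - m * (η / n)) : ℝ) *
          ((B (t (m + 1)) ω - B (t m) ω : ℝ)) * I) ∂P := by
        congr 1
        ext ω
        rw [← Complex.exp_sum, wienerSum, Finset.sum_range]
        push_cast
        rw [Finset.sum_mul]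
        simp [t]
    _ = _ := by
        rw [hprod, ← Complex.exp_sum, Finset.sum_range]
        push_cast
        rw [← Finset.sum_div, Finset.sum_neg_distrib]

/-- The `σ`-algebra is left free and only times up to `η` are used, so that the lemma applies to the
past of the scheme, to the later increments and to path space. -/
lemma measurable_wienerSum {Ω : Type*} {m : MeasurableSpace Ω} {B : ℝ≥0 → Ω → ℝ} (f : ℝ → ℝ) {η : ℝ}
    (hη : 0 ≤ η) (hB : ∀ t : ℝ≥0, (t : ℝ) ≤ η → Measurable[m] (B t)) (n : ℕ) :
    Measurable[m] fun ω => wienerSum f η (fun r => B r.toNNReal ω) n := by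
  unfold wienerSum
  refine Finset.measurable_fun_sum _ fun k hk => ?_
  have hk' : ((k + 1 : ℕ) : ℝ) ≤ n := by exact_mod_cast Finset.mem_range.1 hk
  have hn : (0 : ℝ) < n := lt_of_lt_of_le (by positivity) hk'
  have h1 : ((k + 1 : ℕ) : ℝ) * (η / n) ≤ η := by
    calc ((k + 1 : ℕ) : ℝ) * (η / n) ≤ n * (η / n) := by gcongr
      _ = η := by field_simp
  have h2 : (k : ℝ) * (η / n) ≤ ((k + 1 : ℕ) : ℝ) * (η / n) := by gcongr; simp
  refine Measurable.const_mul (Measurable.sub (hB _ ?_) (hB _ ?_)) _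
  · rwa [Real.coe_toNNReal _ (by positivity)]
  · rw [Real.coe_toNNReal _ (by positivity)]; exact h2.trans h1

open Complex in
/-- The characteristic function of a sum of Wiener integrals with respect to the coordinates of a
Brownian motion. -/
lemma integral_exp_sum_wienerIntegral [IsProbabilityMeasure P] {d : ℕ} {B : ℝ≥0 → Ω → Vec d}
    (hB : IsBrownianMotion B P) {η : ℝ} (hη : 0 < η) {f f' : Fin d → ℝ → ℝ}
    (hf : ∀ j u, HasDerivAt (f j) (f' j u) u) (hf' : ∀ j, Continuous (f' j)) :
    ∫ ω, cexp ((∑ j, wienerIntegral (f j) (f' j) η (fun r => B r.toNNReal ω j) : ℝ) * I) ∂P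
      = cexp (-(∑ j, ∫ u in (0 : ℝ)..η, f j u ^ 2 : ℝ) / 2) := by
  have hm (j : Fin d) (t : ℝ≥0) : Measurable fun ω => B t ω j :=
    (EuclideanSpace.proj (𝕜 := ℝ) j).continuous.measurable.comp (hB.measurable t)
  have hS (j : Fin d) (n : ℕ) : Measurable fun ω => wienerSum (f j) η (fun r => B r.toNNReal ω j) n :=
    measurable_wienerSum (B := fun t ω => B t ω j) (f j) hη.le (fun t _ => hm j t) n
  have hfc (j) : Continuous (f j) := continuous_iff_continuousAt.2 fun u => (hf j u).continuousAt
  have hpaths : ∀ᵐ ω ∂P, ∀ j, Filter.Tendsto (wienerSum (f j) η (fun r => B r.toNNReal ω j))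
      Filter.atTop (nhds (wienerIntegral (f j) (f' j) η (fun r => B r.toNNReal ω j))) := by
    rw [ae_all_iff]
    intro j
    filter_upwards [(hB.coord j).cont, (hB.coord j).eval_zero_ae_eq_zero] with ω h1 h2
    exact tendsto_wienerSum hη (hf j) (hf' j) (h1.comp continuous_real_toNNReal) (by simpa using h2)
  have hlim : Filter.Tendsto (fun n => ∫ ω, cexp ((∑ j,
      wienerSum (f j) η (fun r => B r.toNNReal ω j) n : ℝ) * I) ∂P) Filter.atTop
      (nhds (∫ ω, cexp ((∑ j,
        wienerIntegral (f j) (f' j) η (fun r => B r.toNNReal ω j) : ℝ) * I) ∂P)) := by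
    -- The integrands have modulus one, so the constant `1` dominates.
    refine tendsto_integral_of_dominated_convergence (fun _ => 1) (fun n => ?_)
      (integrable_const 1) (fun n => ?_) ?_
    · refine Measurable.aestronglyMeasurable ?_
      have := Finset.measurable_fun_sum Finset.univ fun j _ => hS j n
      fun_prop
    · filter_upwards with ω
      rw [Complex.norm_exp_ofReal_mul_I]
    · filter_upwards [hpaths] with ω hω
      have : Continuous fun y : ℝ => cexp (y * I) := by fun_prop
      exact (this.tendsto _).comp (tendsto_finsetSum _ fun j _ => hω j)
  have hval (n : ℕ) : ∫ ω, cexp ((∑ j, wienerSum (f j) η (fun r => B r.toNNReal ω j) n : ℝ) * I) ∂P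
      = cexp (-(∑ j, ∑ m ∈ Finset.range n, f j (η - m * (η / n)) ^ 2 * (η / n) : ℝ) / 2) := by
    -- A Riemann sum reads finitely many values, hence is measurable for the product `σ`-algebra on
    -- paths; independence of the coordinates is therefore used before the limit is taken.
    have hwm (j) : Measurable fun w : ℝ≥0 → ℝ => wienerSum (f j) η (fun r => w r.toNNReal) n :=
      measurable_wienerSum (B := fun (t : ℝ≥0) (w : ℝ≥0 → ℝ) => w t) (f j) hη.le (fun t _ => measurable_pi_apply t) n
    have h := hB.indep.integral_fun_prod_comp
      (f := fun j w => cexp (wienerSum (f j) η (fun r => w r.toNNReal) n * I))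
      (fun j => (measurable_pi_lambda _ fun t => hm j t).aemeasurable)
      (fun j => by
        have := hwm j
        exact Measurable.aestronglyMeasurable (by fun_prop))
    simp_rw [integral_exp_wienerSum (hB.coord _).toIsPreBrownianReal hη, ← Complex.exp_sum] at h
    rw [← Finset.sum_div, Finset.sum_neg_distrib] at h
    push_cast at h ⊢
    simp_rw [Finset.sum_mul]
    exact h
  have hlim' : Filter.Tendsto (fun n : ℕ =>
      cexp (-(∑ j, ∑ m ∈ Finset.range n, f j (η - m * (η / n)) ^ 2 * (η / n) : ℝ) / 2)) Filter.atTop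
      (nhds (cexp (-(∑ j, ∫ u in (0 : ℝ)..η, f j u ^ 2 : ℝ) / 2))) := by
    have hj (j) : Filter.Tendsto (fun n : ℕ => ∑ m ∈ Finset.range n,
        f j (η - m * (η / n)) ^ 2 * (η / n)) Filter.atTop
        (nhds (∫ u in (0 : ℝ)..η, f j u ^ 2)) := by
      have hc : Continuous fun r => f j (η - r) ^ 2 :=
        ((hfc j).comp (continuous_const.sub continuous_id)).pow 2
      have h1 := tendsto_sum_mul_integral hη hc (continuous_const (y := (1 : ℝ)))
        (fun n m => m * (η / n)) (fun n m => ⟨le_rfl, by gcongr; simp⟩)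
      have h2 : ∫ r in (0 : ℝ)..η, f j (η - r) ^ 2 * 1 = ∫ u in (0 : ℝ)..η, f j u ^ 2 := by
        simp only [mul_one]
        rw [intervalIntegral.integral_comp_sub_left (fun u => f j u ^ 2)]
        simp
      rw [h2] at h1
      refine h1.congr fun n => Finset.sum_congr rfl fun m _ => ?_
      rw [intervalIntegral.integral_const]
      push_cast
      simp
      left; ring
    have hc : Continuous fun y : ℝ => cexp (-(y : ℂ) / 2) := by fun_prop
    exact (hc.tendsto _).comp (tendsto_finsetSum _ fun j _ => hj j)
  refine tendsto_nhds_unique hlim (hlim'.congr fun n => (hval n).symm)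

/-! ### Independence and conditional laws -/

section Independence

variable {Ω : Type*} [MeasurableSpace Ω] {P : Measure Ω}

/-- The joint law of the pairs is a product over `i` of product measures, and regrouping the factors
separates all `X i` from all `Y i`. -/
lemma indepFun_pi [IsProbabilityMeasure P] {ι α β : Type*} [Fintype ι] [MeasurableSpace α]
    [MeasurableSpace β] {X : ι → Ω → α} {Y : ι → Ω → β} (hX : ∀ i, AEMeasurable (X i) P)
    (hY : ∀ i, AEMeasurable (Y i) P) (h : iIndepFun (fun i ω => (X i ω, Y i ω)) P)
    (hXY : ∀ i, IndepFun (X i) (Y i) P) :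
    IndepFun (fun ω i => X i ω) (fun ω i => Y i ω) P := by
  have hXp (i) := Measure.isProbabilityMeasure_map (hX i)
  have hYp (i) := Measure.isProbabilityMeasure_map (hY i)
  have mX : AEMeasurable (fun ω i => X i ω) P := aemeasurable_pi_lambda _ hX
  have mY : AEMeasurable (fun ω i => Y i ω) P := aemeasurable_pi_lambda _ hY
  have hpair (i) : AEMeasurable (fun ω => (X i ω, Y i ω)) P := (hX i).prodMk (hY i)
  have h1 := (iIndepFun_iff_map_fun_eq_pi_map hpair).1 h
  have h2 : P.map (fun ω => ((fun i => X i ω), fun i => Y i ω))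
      = (Measure.pi fun i => P.map (X i)).prod (Measure.pi fun i => P.map (Y i)) := by
    rw [← (measurePreserving_arrowProdEquivProdArrow α β ι (fun i => P.map (X i))
      (fun i => P.map (Y i))).map_eq]
    simp_rw [← fun i => (indepFun_iff_map_prod_eq_prod_map_map (hX i) (hY i)).1 (hXY i)]
    rw [← h1, AEMeasurable.map_map_of_aemeasurable
      (MeasurableEquiv.measurable _).aemeasurable (aemeasurable_pi_lambda _ hpair)]
    rfl
  rw [indepFun_iff_map_prod_eq_prod_map_map mX mY, h2]
  -- The laws of the two families are read off as the marginals of the regrouped product.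
  have hfst := congrArg (Measure.map Prod.fst) h2
  have hsnd := congrArg (Measure.map Prod.snd) h2
  rw [AEMeasurable.map_map_of_aemeasurable measurable_fst.aemeasurable (mX.prodMk mY),
    Measure.map_fst_prod] at hfst
  rw [AEMeasurable.map_map_of_aemeasurable measurable_snd.aemeasurable (mX.prodMk mY),
    Measure.map_snd_prod] at hsnd
  simp only [measure_univ, one_smul] at hfst hsnd
  rw [← hfst, ← hsnd]
  rfl

/-- Both hypotheses together make the joint law a triple product, and products of measures are
associative. -/
lemma IndepFun.prodMk_left_of_indepFun [IsFiniteMeasure P] {α β δ : Type*} [MeasurableSpace α]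
    [MeasurableSpace β] [MeasurableSpace δ] {X : Ω → α} {Y : Ω → β} {Z : Ω → δ}
    (hX : AEMeasurable X P) (hY : AEMeasurable Y P) (hZ : AEMeasurable Z P)
    (h : IndepFun X (fun ω => (Y ω, Z ω)) P) (hYZ : IndepFun Y Z P) :
    IndepFun (fun ω => (X ω, Y ω)) Z P := by
  have hXY : IndepFun X Y P := h.comp measurable_id measurable_fst
  rw [indepFun_iff_map_prod_eq_prod_map_map (hX.prodMk hY) hZ,
    (indepFun_iff_map_prod_eq_prod_map_map hX hY).1 hXY]
  rw [indepFun_iff_map_prod_eq_prod_map_map hX (hY.prodMk hZ),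
    (indepFun_iff_map_prod_eq_prod_map_map hY hZ).1 hYZ, ← Measure.prodAssoc_prod] at h
  refine MeasurableEquiv.prodAssoc.map_measurableEquiv_injective ?_
  rw [← h, AEMeasurable.map_map_of_aemeasurable (MeasurableEquiv.measurable _).aemeasurable
    ((hX.prodMk hY).prodMk hZ)]
  rfl

/-- The conditional law of a function of `X` and an independent `Z`, given `X`. -/
lemma condDistrib_ae_eq_map_of_indepFun [IsProbabilityMeasure P] {α β δ : Type*}
    [MeasurableSpace α] [MeasurableSpace β] [MeasurableSpace δ] [StandardBorelSpace δ] [Nonempty δ]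
    {X : Ω → α} {Z : Ω → β} {Y : Ω → δ} {f : α × β → δ} (hX : AEMeasurable X P)
    (hZ : AEMeasurable Z P) (hf : Measurable f) (hXZ : IndepFun X Z P)
    (hY : Y =ᵐ[P] fun ω => f (X ω, Z ω)) :
    ∀ᵐ ω ∂P, condDistrib Y X P (X ω) = (P.map Z).map fun z => f (X ω, z) := by
  have := Measure.isProbabilityMeasure_map hX
  have := Measure.isProbabilityMeasure_map hZ
  have hYm : AEMeasurable Y P := (hf.comp_aemeasurable (hX.prodMk hZ)).congr hY.symm
  -- The kernel sends `x` to the law of `f (x, Z)`. It disintegrates the law of `(X, Y)`, so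
  -- uniqueness of disintegration identifies it with `condDistrib`.
  let κ : Kernel α δ := (Kernel.id ×ₖ Kernel.const α (P.map Z)).map f
  have hκ (x : α) : κ x = (P.map Z).map fun z => f (x, z) := by
    rw [Kernel.map_apply _ hf, Kernel.prod_apply, Kernel.id_apply, Kernel.const_apply,
      Measure.dirac_prod, Measure.map_map hf measurable_prodMk_left]
    rfl
  have : IsMarkovKernel κ := Kernel.IsMarkovKernel.map _ hf
  have key : P.map (fun ω => (X ω, Y ω)) = P.map X ⊗ₘ κ := by
    have h1 : P.map (fun ω => (X ω, Y ω))
        = ((P.map X).prod (P.map Z)).map fun q => (q.1, f q) := by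
      rw [← (indepFun_iff_map_prod_eq_prod_map_map hX hZ).1 hXZ,
        AEMeasurable.map_map_of_aemeasurable (measurable_fst.prodMk hf).aemeasurable
        (hX.prodMk hZ)]
      refine Measure.map_congr ?_
      filter_upwards [hY] with ω hω
      simp [hω]
    rw [h1]
    ext s hs
    have hm : Measurable fun q : α × β => (q.1, f q) := measurable_fst.prodMk hf
    rw [Measure.map_apply hm hs, Measure.prod_apply (hm hs), Measure.compProd_apply hs]
    refine lintegral_congr fun x => ?_
    have hfx : Measurable fun z => f (x, z) := hf.comp measurable_prodMk_left
    rw [hκ, Measure.map_apply hfx (measurable_prodMk_left hs)]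
    rfl
  have h := ae_of_ae_map hX (condDistrib_ae_eq_of_measure_eq_compProd X hYm key)
  filter_upwards [h] with ω hω
  rw [hω, hκ]

end Independence

/-! ### Brownian increments after a fixed time -/

section Shift

variable {Ω : Type*} [MeasurableSpace Ω] {P : Measure Ω} {d : ℕ} {B : ℝ≥0 → Ω → Vec d}

lemma IsBrownianMotion.measurable_coord (hB : IsBrownianMotion B P) (t : ℝ≥0) (j : Fin d) :
    Measurable fun ω => B t ω j :=
  (EuclideanSpace.proj (𝕜 := ℝ) j).continuous.measurable.comp (hB.measurable t)

lemma IsBrownianMotion.shift (hB : IsBrownianMotion B P) (a : ℝ≥0) :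
    IsBrownianMotion (fun t ω => B (a + t) ω - B a ω) P where
  measurable t := (hB.measurable _).sub (hB.measurable _)
  coord j := (hB.coord j).shift a
  indep := hB.indep.comp (fun _ (w : ℝ≥0 → ℝ) (t : ℝ≥0) => w (a + t) - w a) fun _ => by fun_prop

/-- Past and future are independent within each coordinate, and the coordinates are independent of
each other; `indepFun_pi` combines the two facts. -/
lemma IsBrownianMotion.indepFun_shift [IsProbabilityMeasure P] (hB : IsBrownianMotion B P)
    (a : ℝ≥0) :
    IndepFun (fun ω (t : Set.Iic a) => B t ω) (fun ω (t : ℝ≥0) => B (a + t) ω - B a ω) P := by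
  have hm := hB.measurable_coord
  have h := indepFun_pi (P := P) (X := fun j ω (t : Set.Iic a) => B t ω j)
    (Y := fun j ω (t : ℝ≥0) => B (a + t) ω j - B a ω j)
    (fun j => (measurable_pi_lambda _ fun t : Set.Iic a => hm t j).aemeasurable)
    (fun j => (measurable_pi_lambda _ fun t => (hm _ j).sub (hm a j)).aemeasurable)
    (hB.indep.comp (fun _ (w : ℝ≥0 → ℝ) =>
      ((fun t : Set.Iic a => w t), fun t : ℝ≥0 => w (a + t) - w a)) fun _ => by fun_prop)
    (fun j => ((hB.coord j).toIsPreBrownianReal.indepFun_shift a).symm)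
  exact h.comp (φ := fun (w : Fin d → Set.Iic a → ℝ) t => (WithLp.toLp 2 fun j => w j t : Vec d))
    (ψ := fun (w : Fin d → ℝ≥0 → ℝ) t => (WithLp.toLp 2 fun j => w j t : Vec d))
    (measurable_pi_lambda _ fun t => (WithLp.measurable_toLp 2 _).comp (by fun_prop))
    (measurable_pi_lambda _ fun t => (WithLp.measurable_toLp 2 _).comp (by fun_prop))

/-- The initial value and the path up to time `a` are independent of the increments after `a`. -/
lemma IsBrownianMotion.indepFun_init_past_shift [IsProbabilityMeasure P]
    (hB : IsBrownianMotion B P) {E : Type*} [MeasurableSpace E] {x₀ : Ω → E} (hx₀ : Measurable x₀)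
    (h : IndepFun x₀ (fun (ω : Ω) (t : ℝ≥0) => B t ω) P) (a : ℝ≥0) :
    IndepFun (fun ω => (x₀ ω, fun t : Set.Iic a => B t ω))
      (fun ω (t : ℝ≥0) => B (a + t) ω - B a ω) P := by
  refine IndepFun.prodMk_left_of_indepFun hx₀.aemeasurable
    (measurable_pi_lambda _ fun t => hB.measurable _).aemeasurable
    (measurable_pi_lambda _ fun t => (hB.measurable _).sub (hB.measurable _)).aemeasurable ?_
    (hB.indepFun_shift a)
  refine h.comp (φ := id) (ψ := fun w : ℝ≥0 → Vec d =>
      ((fun t : Set.Iic a => w t), fun t : ℝ≥0 => w (a + t) - w a)) measurable_id ?_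
  fun_prop

end Shift

/-! ### The noise of one step -/

section Noise

variable {d : ℕ} {γ : ℝ} (hγ : γ ≠ 0) (η : ℝ)

/-- The random part of the end point of a step, driven by a path `w` that starts at `0`. -/
noncomputable def noise (w : ℝ → Vec d) : Phase d :=
  WithLp.toLp 2 fun p => √(2 * γ) *
    wienerIntegral (adjoint hγ p.1).kernel (adjoint hγ p.1).kernel' η fun r => w r p.2

/-- A version of `noise` that is measurable in the values of the path on `[0, η]`. -/
noncomputable def noiseLim (w : ℝ → Vec d) : Phase d :=
  WithLp.toLp 2 fun p => √(2 * γ) *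
    Filter.atTop.limUnder (wienerSum (adjoint hγ p.1).kernel η fun r => w r p.2)

variable {η}

lemma noiseLim_eq_noise (hη : 0 < η) {w : ℝ → Vec d} (hw : ∀ j, Continuous fun r => w r j)
    (hw0 : ∀ j, w 0 j = 0) : noiseLim hγ η w = noise hγ η w := by
  ext p
  simp only [noiseLim, noise]
  rw [(tendsto_wienerSum hη (adjoint hγ p.1).hasDerivAt_kernel (adjoint hγ p.1).continuous_kernel'
    (hw p.2) (hw0 p.2)).limUnder_eq]

/-- Limits of measurable sums are measurable without any continuity of paths, which holds only
almost surely. This is what `noiseLim` offers over `noise`. -/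
lemma measurable_noiseLim {Ω : Type*} {m : MeasurableSpace Ω} (hη : 0 ≤ η)
    {B : ℝ≥0 → Ω → Vec d} (hB : ∀ t : ℝ≥0, (t : ℝ) ≤ η → Measurable[m] (B t)) :
    Measurable[m] fun ω => noiseLim hγ η fun r => B r.toNNReal ω := by
  refine (WithLp.measurable_toLp 2 _).comp (measurable_pi_lambda _ fun p => ?_)
  refine Measurable.const_mul (StronglyMeasurable.measurable (StronglyMeasurable.limUnder
    fun n => Measurable.stronglyMeasurable ?_)) _
  exact measurable_wienerSum (B := fun t ω => B t ω p.2) _ hη (fun t ht =>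
    (EuclideanSpace.proj (𝕜 := ℝ) p.2).continuous.measurable.comp (hB t ht)) n

lemma wienerIntegral_sum {ι : Type*} [Fintype ι] (c : ι → ℝ) {f f' : ι → ℝ → ℝ}
    (hf' : ∀ i, Continuous (f' i)) {w : ℝ → ℝ} (hw : Continuous w) (η : ℝ) :
    wienerIntegral (fun u => ∑ i, c i * f i u) (fun u => ∑ i, c i * f' i u) η w
      = ∑ i, c i * wienerIntegral (f i) (f' i) η w := by
  have hi (i : ι) : IntervalIntegrable (fun r => c i * (f' i (η - r) * w r)) volume 0 η :=
    (continuous_const.mul (((hf' i).comp (continuous_const.sub continuous_id)).mul hw)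
      ).intervalIntegrable _ _
  simp only [wienerIntegral, Finset.sum_mul, mul_add, mul_assoc]
  rw [intervalIntegral.integral_finsetSum fun i _ => hi i, ← Finset.sum_add_distrib]
  simp only [intervalIntegral.integral_const_mul]

open Complex in
-- By linearity, the inner product with `ξ` is a sum over coordinates `j` of Wiener integrals with
-- kernel `√(2γ) ∑ᵢ ξ(i, j) K_i`, whose squared `L²` norms add up to the quadratic form of `covMat`.
lemma charFun_noise {Ω : Type*} [MeasurableSpace Ω] {P : Measure Ω} [IsProbabilityMeasure P]
    {B : ℝ≥0 → Ω → Vec d} (hB : IsBrownianMotion B P) (hγ' : 0 ≤ γ) (hη : 0 < η) (ξ : Phase d) :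
    ∫ ω, cexp ((inner ℝ (noise hγ η fun r => B r.toNNReal ω) ξ : ℝ) * I) ∂P
      = cexp (-(ξ.ofLp ⬝ᵥ (covMat d γ η).mulVec ξ.ofLp : ℝ) / 2) := by
  have hc (i) := (adjoint hγ i).continuous_kernel'
  have key := integral_exp_sum_wienerIntegral hB hη
    (f := fun j u => ∑ i, (√(2 * γ) * ξ (i, j)) * (adjoint hγ i).kernel u)
    (f' := fun j u => ∑ i, (√(2 * γ) * ξ (i, j)) * (adjoint hγ i).kernel' u)
    (fun j u => HasDerivAt.fun_sum fun i _ =>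
      ((adjoint hγ i).hasDerivAt_kernel u).const_mul _)
    (fun j => continuous_finsetSum _ fun i _ => continuous_const.mul (hc i))
  rw [dotProduct_covMat_mulVec hγ]
  refine Eq.trans (integral_congr_ae ?_) (key.trans ?_)
  · have hcont : ∀ᵐ ω ∂P, ∀ j, Continuous fun t : ℝ≥0 => B t ω j :=
      ae_all_iff.2 fun j => (hB.coord j).cont
    filter_upwards [hcont] with ω hω
    congr 3
    simp only [noise, PiLp.inner_apply, Fintype.sum_prod_type, RCLike.inner_apply, conj_trivial]
    rw [Finset.sum_comm]
    refine Finset.sum_congr rfl fun j _ => ?_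
    have hw : Continuous fun r : ℝ => B r.toNNReal ω j := (hω j).comp continuous_real_toNNReal
    rw [wienerIntegral_sum _ hc hw]
    exact Finset.sum_congr rfl fun i _ => by ring
  · congr 4
    refine Finset.sum_congr rfl fun j _ => ?_
    rw [← intervalIntegral.integral_const_mul]
    refine intervalIntegral.integral_congr fun u _ => ?_
    simp only [mul_assoc, ← Finset.mul_sum]
    rw [mul_pow, Real.sq_sqrt (mul_nonneg zero_le_two hγ'), mul_assoc]

lemma noiseLim_ae_eq_noise {Ω : Type*} [MeasurableSpace Ω] {P : Measure Ω} {B : ℝ≥0 → Ω → Vec d}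
    (hB : IsBrownianMotion B P) (hη : 0 < η) :
    (fun ω => noiseLim hγ η fun r => B r.toNNReal ω)
      =ᵐ[P] fun ω => noise hγ η fun r => B r.toNNReal ω := by
  have h1 : ∀ᵐ ω ∂P, ∀ j, Continuous fun t : ℝ≥0 => B t ω j :=
    ae_all_iff.2 fun j => (hB.coord j).cont
  have h2 : ∀ᵐ ω ∂P, ∀ j, B 0 ω j = 0 :=
    ae_all_iff.2 fun j => (hB.coord j).eval_zero_ae_eq_zero
  filter_upwards [h1, h2] with ω hω hω0
  exact noiseLim_eq_noise hγ hη (fun j => (hω j).comp continuous_real_toNNReal)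
    (fun j => by simpa using hω0 j)

/-- The noise of a step is Gaussian with covariance matrix `covMat d γ η`. -/
lemma map_noiseLim {Ω : Type*} [MeasurableSpace Ω] {P : Measure Ω} [IsProbabilityMeasure P]
    {B : ℝ≥0 → Ω → Vec d} (hB : IsBrownianMotion B P) (hγ' : 0 < γ) (hη : 0 < η) :
    P.map (fun ω => noiseLim hγ η fun r => B r.toNNReal ω)
      = multivariateGaussian 0 (covMat d γ η) := by
  have hm : Measurable fun ω => noiseLim hγ η fun r => B r.toNNReal ω :=
    measurable_noiseLim hγ hη.le fun t _ => hB.measurable t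
  have := Measure.isProbabilityMeasure_map (μ := P) hm.aemeasurable
  refine Measure.ext_of_charFun (funext fun ξ => ?_)
  rw [charFun_multivariateGaussian (covMat_posSemidef d hγ' hη.le), charFun_apply,
    integral_map hm.aemeasurable (by fun_prop)]
  refine (integral_congr_ae ?_).trans ((charFun_noise hγ hB hγ'.le hη ξ).trans ?_)
  · filter_upwards [noiseLim_ae_eq_noise hγ hB hη] with ω hω
    rw [hω]
  · simp [neg_div]

end Noise

lemma multivariateGaussian_eq_map_zero {ι : Type*} [Fintype ι] [DecidableEq ι]
    (m : EuclideanSpace ℝ ι) (S : Matrix ι ι ℝ) :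
    multivariateGaussian m S = (multivariateGaussian 0 S).map fun z => m + z := by
  unfold multivariateGaussian
  rw [Measure.map_map (by fun_prop) (by fun_prop)]
  simp [Function.comp_def]

/-! ### The step as a function of its starting point and of the noise -/

/-- Each of the four adjoint solutions yields one block. The identity is pathwise, so it also shows
that the end point is uniquely determined by the starting point and the driving path. -/
lemma step_eq {d : ℕ} {U : Vec d → ℝ} {α : ℕ} {γ a η : ℝ} (hγ : γ ≠ 0) (hη : 0 ≤ η)
    {w : ℝ → Vec d} (hw : Continuous w) {x : Phase d}
    {X₁ X₂ X₃ : ℝ → Phase d} (h₁ : SolvesFirstStage γ a (a + η) w x X₁)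
    (h₂ : SolvesNextStage (gradTaylor U α) γ a (a + η) w x X₁ X₂)
    (h₃ : SolvesNextStage (gradTaylor U α) γ a (a + η) w x X₂ X₃) :
    X₃ (a + η) = meanVec U α γ η x + noise hγ η fun r => w (a + r) - w a := by
  have hblock (i : Fin 4) : block i (X₃ (a + η))
      = gradPart U α γ η x i + ∑ j : Fin 4, muCoeff γ η i j • block j x
        + block i (noise hγ η fun r => w (a + r) - w a) := by
    have h := step_identity hη hw.continuousOn h₁ h₂ h₃ (adjoint hγ i)
    rw [adjoint_zero hγ (fun i => block i (X₃ (a + η))), muCoeff_zero, muCoeff_one, muCoeff_two,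
      muCoeff_three] at h
    have hn : block i (noise hγ η fun r => w (a + r) - w a) = √(2 * γ) •
        ((adjoint hγ i).kernel 0 • (w (a + η) - w a)
          + ∫ r in (0 : ℝ)..η, (adjoint hγ i).kernel' (η - r) • (w (a + r) - w a)) := by
      have hk : Continuous fun r => (adjoint hγ i).kernel' (η - r) :=
        (adjoint hγ i).continuous_kernel'.comp (continuous_const.sub continuous_id)
      ext j
      have := ContinuousLinearMap.intervalIntegral_comp_comm (μ := volume)
        (EuclideanSpace.proj (𝕜 := ℝ) j : Vec d →L[ℝ] ℝ)
        (f := fun r => (adjoint hγ i).kernel' (η - r) • (w (a + r) - w a)) (a := 0) (b := η)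
        (Continuous.intervalIntegrable (by fun_prop) _ _)
      simp only [PiLp.proj_apply] at this
      simp [block, noise, wienerIntegral, ← this, mul_add]
    rw [h, hn, ← gradPart_eq hγ, Fin.sum_univ_four]
    abel
  rw [← assemble_block (X₃ (a + η))]
  simp only [hblock]
  ext p
  simp [assemble, meanVec, block]

lemma noise_congr {d : ℕ} {γ η : ℝ} (hγ : γ ≠ 0) (hη : 0 ≤ η) {w w' : ℝ → Vec d}
    (h : ∀ r ∈ Set.Icc 0 η, w r = w' r) : noise hγ η w = noise hγ η w' := by
  ext p
  simp only [noise, wienerIntegral]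
  rw [h η ⟨hη, le_rfl⟩]
  congr 2
  refine intervalIntegral.integral_congr fun r hr => ?_
  rw [Set.uIcc_of_le hη] at hr
  simp only [h r hr]

/-! ### The iterates of the scheme -/

section Scheme

variable {Ω : Type*} {d : ℕ}

/-- A version of the iterates of the scheme that is measurable with respect to the initial value
and the past of the Brownian motion. -/
noncomputable def schemeVersion (U : Vec d → ℝ) (α : ℕ) {γ : ℝ} (hγ : γ ≠ 0) (η : ℝ)
    (B : ℝ≥0 → Ω → Vec d) (x₀ : Ω → Phase d) : ℕ → Ω → Phase d
  | 0 => x₀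
  | k + 1 => fun ω => meanVec U α γ η (schemeVersion U α hγ η B x₀ k ω) +
      noiseLim hγ η fun r =>
        B ((k * η).toNNReal + r.toNNReal) ω - B (k * η).toNNReal ω

variable {U : Vec d → ℝ} {α : ℕ} {γ : ℝ} (hγ : γ ≠ 0) {η : ℝ} (hη : 0 ≤ η)
  {B : ℝ≥0 → Ω → Vec d} {x₀ : Ω → Phase d}

/-- The `σ`-algebra generated by `x₀` and by the path up to time `a`. -/
abbrev initPast (x₀ : Ω → Phase d) (B : ℝ≥0 → Ω → Vec d) (a : ℝ≥0) : MeasurableSpace Ω :=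
  MeasurableSpace.comap (fun ω => (x₀ ω, fun t : Set.Iic a => B t ω)) inferInstance

lemma measurable_init_initPast (a : ℝ≥0) : Measurable[initPast x₀ B a] x₀ :=
  measurable_fst.comp (comap_measurable fun ω => (x₀ ω, fun t : Set.Iic a => B t ω))

lemma measurable_path_initPast {a t : ℝ≥0} (ht : t ≤ a) : Measurable[initPast x₀ B a] (B t) :=
  ((measurable_pi_apply (⟨t, ht⟩ : Set.Iic a)).comp measurable_snd).comp
    (comap_measurable fun ω => (x₀ ω, fun t : Set.Iic a => B t ω))

lemma initPast_le {m : MeasurableSpace Ω} {a : ℝ≥0} (hx₀ : Measurable[m] x₀)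
    (hB : ∀ t ≤ a, Measurable[m] (B t)) : initPast x₀ B a ≤ m :=
  Measurable.comap_le (hx₀.prodMk (measurable_pi_lambda _ fun t => hB t t.2))

include hη in
-- Adaptedness, by induction: the noise of step `k` reads the path only up to time `(k+1)η`.
lemma measurable_schemeVersion (k : ℕ) :
    Measurable[initPast x₀ B (k * η).toNNReal] (schemeVersion U α hγ η B x₀ k) := by
  induction k with
  | zero => exact measurable_init_initPast _
  | succ k ih =>
    have hle : (k * η).toNNReal ≤ ((k + 1 : ℕ) * η).toNNReal :=
      Real.toNNReal_le_toNNReal (by gcongr; simp)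
    have hmono : initPast x₀ B (k * η).toNNReal ≤ initPast x₀ B ((k + 1 : ℕ) * η).toNNReal :=
      initPast_le (measurable_init_initPast _) fun t ht => measurable_path_initPast (ht.trans hle)
    refine Measurable.add ((continuous_meanVec U α γ η).measurable.comp (ih.mono hmono le_rfl)) ?_
    refine measurable_noiseLim (B := fun t ω => B ((k * η).toNNReal + t) ω - B (k * η).toNNReal ω)
      hγ hη fun t ht => Measurable.sub (measurable_path_initPast ?_)
        (measurable_path_initPast hle)
    rw [← NNReal.coe_le_coe, NNReal.coe_add, Real.coe_toNNReal _ (by positivity),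
      Real.coe_toNNReal _ (by positivity)]
    push_cast
    linarith

variable [MeasurableSpace Ω] {P : Measure Ω} [IsProbabilityMeasure P]

include hη in
lemma indepFun_schemeVersion (hB : IsBrownianMotion B P) (hx₀ : Measurable x₀)
    (h : IndepFun x₀ (fun (ω : Ω) (t : ℝ≥0) => B t ω) P) (k : ℕ) :
    IndepFun (schemeVersion U α hγ η B x₀ k)
      (fun ω => noiseLim hγ η fun r =>
        B ((k * η).toNNReal + r.toNNReal) ω - B (k * η).toNNReal ω) P := by
  have hi := hB.indepFun_init_past_shift hx₀ h (k * η).toNNReal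
  rw [IndepFun_iff_Indep] at hi ⊢
  refine indep_of_indep_of_le_left (indep_of_indep_of_le_right hi ?_)
    (measurable_schemeVersion hγ hη k).comap_le
  refine Measurable.comap_le (measurable_noiseLim
    (B := fun t ω => B ((k * η).toNNReal + t) ω - B (k * η).toNNReal ω) hγ hη fun t _ => ?_)
  exact (measurable_pi_apply t).comp
    (comap_measurable fun ω (t : ℝ≥0) => B ((k * η).toNNReal + t) ω - B (k * η).toNNReal ω)

include hη in
lemma measurable_schemeVersion' (hB : ∀ t, Measurable (B t)) (hx₀ : Measurable x₀) (k : ℕ) :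
    Measurable (schemeVersion U α hγ η B x₀ k) :=
  (measurable_schemeVersion hγ hη k).mono (initPast_le hx₀ fun t _ => hB t) le_rfl

omit [IsProbabilityMeasure P] in
-- The scheme imposes measurability only at time zero. This identification supplies it for all
-- iterates, together with independence from the later increments.
lemma scheme_ae_eq (hη : 0 < η) (hB : IsBrownianMotion B P) {x : ℕ → Ω → Phase d}
    {xhat xtilde xbar : ℕ → ℝ → Ω → Phase d}
    (hx : IsFourthOrderScheme U α γ η B P x xhat xtilde xbar) (k : ℕ) :
    x k =ᵐ[P] schemeVersion U α hγ η B (x 0) k := by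
  induction k with
  | zero => rfl
  | succ k ih =>
    have hcont : ∀ᵐ ω ∂P, ∀ j, Continuous fun t : ℝ≥0 => B t ω j :=
      ae_all_iff.2 fun j => (hB.coord j).cont
    filter_upwards [ih, hcont, noiseLim_ae_eq_noise hγ (hB.shift (k * η).toNNReal) hη,
      hx.stage_one k, hx.stage_two k, hx.stage_three k, hx.next k] with ω hω hc hn h1 h2 h3 h4
    have he : ((k : ℝ) + 1) * η = k * η + η := by ring
    rw [he] at h1 h2 h3 h4
    have hw : Continuous fun t : ℝ => B t.toNNReal ω :=
      ((PiLp.continuous_toLp 2 _).comp (continuous_pi hc)).comp continuous_real_toNNReal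
    rw [h4, step_eq hγ hη.le hw h1 h2 h3]
    simp only [schemeVersion]
    rw [hn, ← hω]
    congr 1
    -- The two shifted paths agree only for `r ≥ 0`, where `Real.toNNReal` is additive; the noise
    -- sees nothing else.
    refine noise_congr hγ hη.le fun r hr => ?_
    rw [Real.toNNReal_add (by positivity) hr.1]

end Scheme

end FourthLMC

/-! ### The conditional law of one step -/

theorem mainTheorem6 {Ω : Type*} [MeasurableSpace Ω] (P : Measure Ω) [IsProbabilityMeasure P]
    (d : ℕ) (U : FourthLMC.Vec d → ℝ) (α : ℕ) (hα : 1 ≤ α) (hU : ContDiff ℝ α U)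
    (γ η : ℝ) (hγ : 0 < γ) (hη : 0 < η)
    (B : ℝ≥0 → Ω → FourthLMC.Vec d) (hB : FourthLMC.IsBrownianMotion B P)
    (x : ℕ → Ω → FourthLMC.Phase d) (xhat xtilde xbar : ℕ → ℝ → Ω → FourthLMC.Phase d)
    (hx : FourthLMC.IsFourthOrderScheme U α γ η B P x xhat xtilde xbar) (k : ℕ) :
    (FourthLMC.covMat d γ η).PosSemidef ∧
    AEMeasurable (x k) P ∧ AEMeasurable (x (k + 1)) P ∧
    ∀ᵐ ω ∂P, condDistrib (x (k + 1)) (x k) P (x k ω) =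
      multivariateGaussian (FourthLMC.meanVec U α γ η (x k ω)) (FourthLMC.covMat d γ η) := by
  have hver := FourthLMC.scheme_ae_eq hγ.ne' hη hB hx
  have hmeas (k : ℕ) : AEMeasurable (x k) P :=
    (FourthLMC.measurable_schemeVersion' hγ.ne' hη.le hB.measurable
      hx.measurable_init k).aemeasurable.congr (hver k).symm
  refine ⟨FourthLMC.covMat_posSemidef d hγ hη.le, hmeas k, hmeas (k + 1), ?_⟩
  have hBk := hB.shift (k * η).toNNReal
  have hnoise := FourthLMC.measurable_noiseLim hγ.ne' hη.le fun t _ => hBk.measurable t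
  have hind := (FourthLMC.indepFun_schemeVersion (U := U) (α := α) hγ.ne' hη.le hB
    hx.measurable_init hx.indep_init k).congr (hver k).symm (Filter.EventuallyEq.refl _ _)
  have hstep : x (k + 1) =ᵐ[P] fun ω => FourthLMC.meanVec U α γ η (x k ω) +
      FourthLMC.noiseLim hγ.ne' η fun r =>
        B ((k * η).toNNReal + r.toNNReal) ω - B (k * η).toNNReal ω := by
    filter_upwards [hver k, hver (k + 1)] with ω h1 h2
    rw [h2, h1, FourthLMC.schemeVersion]
  have hf : Measurable fun q : FourthLMC.Phase d × FourthLMC.Phase d =>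
      FourthLMC.meanVec U α γ η q.1 + q.2 :=
    ((FourthLMC.continuous_meanVec U α γ η).measurable.comp measurable_fst).add measurable_snd
  -- With the current iterate fixed, the step is a translation of the independent Gaussian noise by
  -- the mean.
  filter_upwards [FourthLMC.condDistrib_ae_eq_map_of_indepFun (hmeas k) hnoise.aemeasurable hf hind
    hstep] with ω hω
  rw [hω, FourthLMC.map_noiseLim hγ.ne' hBk hγ hη,
    ← FourthLMC.multivariateGaussian_eq_map_zero]
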